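/- Let $M=\{(z,\ell)\in\mathbb{C}^2\times\mathbb{CP}^1: z\in\ell\}$ be the total space of $\mathcal{O}(-1)\to\mathbb{CP}^1$, a complex surface. The Burns metric $g_B$ is the smooth Riemannian metric on $M$ which off the zero section is the pull-back, under $(z,\ell)\mapsto z$, of $$d\rho^2+\tfrac14\rho^2(\sigma_1^2+\sigma_2^2+\sigma_3^2)+\tfrac14(\sigma_1^2+\sigma_2^2),\qquad \rho=|z|,$$ where $\sigma_1,\sigma_2,\sigma_3$ are the left-invariant one-forms on $SU(2)=S^3\subset\mathbb{C}^2$, with $d\sigma_1+\sigma_2\wedge\sigma_3=0$ and cyclic permutations; in the coordinates $z=\lambda(1,w)$, $\ell=[1:w]$, it is $|d\lambda|^2+|d(\lambda w)|^2+|dw|^2/(1+|w|^2)^2$. An isometric embedding of $(M,g)$ into the pseudo-Euclidean space $\mathbb{R}^{r,s}$ with flat metric $\eta$ is a $C^\infty$ map $\iota$ which is a homeomorphism onto its image and satisfies $\iota^*\eta=g$. The isometric embedding class of $(M,g)$ is the smallest integer $k$ such that $(M,g)$ has an isometric embedding into some $\mathbb{R}^{r,s}$ with $r+s-\dim M=k$.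 In an orthonormal frame, with Riemann tensor $R_{abcd}$, put $P_{ab}{}^{cd}=-\tfrac12\epsilon_{abpq}R^{pqcd}$, $\Phi_3=\mathrm{Tr}(P^3)$ and $\Phi_5=\mathrm{Tr}(P^5)$, where $P$ is regarded as an endomorphism of the two-forms. **Theorem 1.1.** The metric $g_B$ is scalar-flat and Kähler, and its isometric embedding class is exactly $3$. More precisely: 1. There is no isometric embedding of $(M,g_B)$ into $\mathbb{R}^{r,s}$ for any $r,s\ge 0$ with $r+s=6$. 2. At every point of $M$, $\Phi_3=\Phi_5=0$. Nevertheless, at every point there are no real endomorphisms $X,Y$ of the two-forms with $P=X+Y$, $\mathrm{tr}\,X=\mathrm{tr}\,Y=0$, $X^2=\lambda I$, $Y^2=\mu I$ for some real $\lambda,\mu$, and $X_{ab}{}^{cb}=Y_{ab}{}^{cb}=0$; and for $\varepsilon_1,\varepsilon_2\in\{1,-1\}$ there are no real symmetric $K,L$ that solve the Gauss equation $R_{abcd}=\varepsilon_1(K_{ac}K_{bd}-K_{ad}K_{bc})+\varepsilon_2(L_{ac}L_{bd}-L_{ad}L_{bc})$. 3. There is an isometric embedding of $(M,g_B)$ into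 Euclidean $\mathbb{R}^7=\mathbb{R}^4\times\mathbb{R}^3$ of the form $(z,\ell)\mapsto(z,S(\ell))$, where $\mathbb{C}^2=\mathbb{R}^4$ and $S$ is a bijection of $\mathbb{CP}^1$ onto the round sphere of radius $\tfrac12$ about the origin of $\mathbb{R}^3$. -/

import Mathlib

open scoped Manifold ContDiff Bundle LinearAlgebra.Projectivization

noncomputable section

namespace RiemGeom

/-! Riemannian metrics, curvature and isometric embeddings -/

section Metric

variable {E : Type} [NormedAddCommGroup E] [NormedSpace ℝ E]
  {M : Type} [TopologicalSpace M] [ChartedSpace E M] [IsManifold 𝓘(ℝ, E) ∞ M]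

variable (E M) in
/-- Smooth Riemannian metrics on a smooth manifold `M` modelled on `E`. -/
abbrev SmoothMetric : Type :=
  Bundle.ContMDiffRiemannianMetric 𝓘(ℝ, E) ∞ E (fun p : M => TangentSpace 𝓘(ℝ, E) p)

/-- The coordinate expression of a metric in the preferred chart at `p`: its pull-back by the
inverse of that chart. -/
def metricInChart (g : SmoothMetric E M) (p : M) (y : E) : E →L[ℝ] E →L[ℝ] ℝ :=
  let B : E →L[ℝ] E →L[ℝ] ℝ := g.inner ((chartAt E p).symm y)
  let A : E →L[ℝ] E := mfderiv 𝓘(ℝ, E) 𝓘(ℝ, E) (chartAt E p).symm y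
  B.bilinearComp A A

/-- Christoffel symbols of the first kind of a metric `G` on an open set of `E`: the linear form
`w ↦ (∂_u G(v, w) + ∂_v G(u, w) - ∂_w G(u, v)) / 2`. -/
def christoffelForm (G : E → E →L[ℝ] E →L[ℝ] ℝ) (y u v : E) : E →L[ℝ] ℝ :=
  (1 / 2 : ℝ) • (fderiv ℝ G y u v + fderiv ℝ G y v u - ((fderiv ℝ G y).flip u).flip v)

/-- Christoffel symbols of the second kind: the vector `Γ(u, v)` with
`G (Γ(u, v), w) = christoffelForm G y u v w` for all `w`. -/
def christoffel (G : E → E →L[ℝ] E →L[ℝ] ℝ) (y u v : E) : E :=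
  (G y).inverse (christoffelForm G y u v)

/-- The second derivatives `∂_u ∂_v G(a, b)` of a metric `G` on an open set of `E`. -/
def secondDeriv (G : E → E →L[ℝ] E →L[ℝ] ℝ) (y u v a b : E) : ℝ :=
  fderiv ℝ (fun z => fderiv ℝ (fun t => G t a b) z v) y u

/-- The covariant Riemann tensor of a metric `G` on an open set of `E`,
`R_abcd = (∂_b ∂_c G_ad + ∂_a ∂_d G_bc - ∂_b ∂_d G_ac - ∂_a ∂_c G_bd) / 2`
`+ G(Γ_bc, Γ_ad) - G(Γ_bd, Γ_ac)`, with the sign for which `R_abab > 0` on round spheres. -/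
def riemannCoord (G : E → E →L[ℝ] E →L[ℝ] ℝ) (y a b c d : E) : ℝ :=
  (secondDeriv G y b c a d + secondDeriv G y a d b c
      - secondDeriv G y b d a c - secondDeriv G y a c b d) / 2
    + G y (christoffel G y b c) (christoffel G y a d)
    - G y (christoffel G y b d) (christoffel G y a c)

/-- The covariant Riemann tensor of a Riemannian metric at a point. -/
def riemann (g : SmoothMetric E M) (p : M) (a b c d : TangentSpace 𝓘(ℝ, E) p) : ℝ :=
  riemannCoord (metricInChart g p) (chartAt E p p) a b c d

/-- Orthonormal frames of the tangent space at a point of a Riemannian four-manifold. -/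
def IsFrame (g : SmoothMetric E M) (p : M) (e : Fin 4 → TangentSpace 𝓘(ℝ, E) p) : Prop :=
  ∀ i j, g.inner p (e i) (e j) = if i = j then 1 else 0

/-- The components of the Riemann tensor in a frame. -/
def riemannFrame (g : SmoothMetric E M) (p : M) (e : Fin 4 → TangentSpace 𝓘(ℝ, E) p)
    (i j k l : Fin 4) : ℝ :=
  riemann g p (e i) (e j) (e k) (e l)

/-- Vanishing of the scalar curvature of a Riemannian four-manifold. -/
def IsScalarFlat (g : SmoothMetric E M) : Prop :=
  ∀ (p : M) (e : Fin 4 → TangentSpace 𝓘(ℝ, E) p), IsFrame g p e →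
    ∑ i, ∑ j, riemannFrame g p e i j i j = 0

/-- The metric is Kähler with respect to the complex structure of the complex manifold `M`: it is
Hermitian, and the two-form `ω(u, v) = g(i u, v)` is closed. The complex structure is multiplication
by `i` in every chart, because the coordinate changes are holomorphic. -/
def IsKahler [NormedSpace ℂ E] [IsManifold 𝓘(ℂ, E) ω M] (g : SmoothMetric E M) : Prop :=
  ∀ p : M,
    (∀ u v : E, metricInChart g p (chartAt E p p) (Complex.I • u) (Complex.I • v)
      = metricInChart g p (chartAt E p p) u v) ∧
    (∀ u v w : E,
      fderiv ℝ (metricInChart g p) (chartAt E p p) u (Complex.I • v) w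
      + fderiv ℝ (metricInChart g p) (chartAt E p p) v (Complex.I • w) u
      + fderiv ℝ (metricInChart g p) (chartAt E p p) w (Complex.I • u) v = 0)

/-- The vector space underlying the pseudo-Euclidean space `ℝ^{r,s}`. -/
abbrev PseudoEuclidean (r s : ℕ) : Type := EuclideanSpace ℝ (Fin r) × EuclideanSpace ℝ (Fin s)

/-- The flat metric of signature `(r, s)`. -/
def flatForm {r s : ℕ} (x y : PseudoEuclidean r s) : ℝ := inner ℝ x.1 y.1 - inner ℝ x.2 y.2

/-- Isometric embeddings of a Riemannian manifold into `ℝ^{r,s}`: smooth maps that pull the flat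
metric back to `g` (so that they are immersions, `g` being nondegenerate), and that are
homeomorphisms onto their image. -/
structure IsIsometricEmbedding (g : SmoothMetric E M) {r s : ℕ}
    (f : M → PseudoEuclidean r s) : Prop where
  contMDiff : ContMDiff 𝓘(ℝ, E) 𝓘(ℝ, PseudoEuclidean r s) ∞ f
  isEmbedding : Topology.IsEmbedding f
  pullback : ∀ (p : M) (u v : TangentSpace 𝓘(ℝ, E) p),
    flatForm (mfderiv 𝓘(ℝ, E) 𝓘(ℝ, PseudoEuclidean r s) f p u)
      (mfderiv 𝓘(ℝ, E) 𝓘(ℝ, PseudoEuclidean r s) f p v) = g.inner p u v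

/-- The isometric embedding class of `(M, g)` is `k`: this is the least integer `k = r + s - dim M`
such that `(M, g)` has an isometric embedding into `ℝ^{r,s}`. -/
def HasEmbeddingClass (g : SmoothMetric E M) (k : ℤ) : Prop :=
  IsLeast {m : ℤ | ∃ r s : ℕ, (r : ℤ) + s - Module.finrank ℝ E = m ∧
    ∃ f : M → PseudoEuclidean r s, IsIsometricEmbedding g f} k

end Metric

/-! Algebra of curvature tensors in four dimensions, in an orthonormal frame -/

/-- The Levi-Civita symbol on four indices. -/
def eps (a b c d : Fin 4) : ℝ :=
  let s : Fin 4 → Fin 4 → ℤ := fun i j => Int.sign ((j : ℤ) - (i : ℤ))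
  ((s a b * s a c * s a d * s b c * s b d * s c d : ℤ) : ℝ)

/-- Tensors `T_{ab}^{cd}`, as matrices indexed by pairs of indices. -/
abbrev PairMatrix : Type := Matrix (Fin 4 × Fin 4) (Fin 4 × Fin 4) ℝ

/-- The tensor `P_{ab}^{cd} = -1/2 ε_{abpq} R^{pqcd}`. -/
def pTensor (R : Fin 4 → Fin 4 → Fin 4 → Fin 4 → ℝ) : PairMatrix :=
  Matrix.of fun I J => -(1 / 2) * ∑ p, ∑ q, eps I.1 I.2 p q * R p q J.1 J.2

/-- `T_{ab}^{cd}` is an endomorphism of the two-forms: it is skew in `ab` and in `cd`. -/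
def IsFormEndo (T : PairMatrix) : Prop :=
  (∀ a b J, T (a, b) J = -T (b, a) J) ∧ ∀ I c d, T I (c, d) = -T I (d, c)

/-- The identity on two-forms, `δ_{[a}^c δ_{b]}^d`. -/
def formId : PairMatrix :=
  Matrix.of fun I J => ((if I.1 = J.1 ∧ I.2 = J.2 then 1 else 0)
    - (if I.1 = J.2 ∧ I.2 = J.1 then 1 else 0)) / 2

/-- The algebraic conditions on one summand of `P` in the Gauss equation: `X` is a trace-free real
endomorphism of the two-forms, its square is a multiple of the identity, and `X_{ab}^{cb} = 0`. -/
def IsGaussSummand (X : PairMatrix) : Prop :=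
  IsFormEndo X ∧ X.trace = 0 ∧ (∃ c : ℝ, X * X = c • formId) ∧ ∀ a c, ∑ b, X (a, b) (c, b) = 0

/-- The Gauss equation of a four-manifold in `ℝ^{r,s}`, `r + s = 6`, with second fundamental forms
`K`, `L` along two orthogonal normals of squared lengths `ε₁`, `ε₂`. -/
def SolvesGauss (R : Fin 4 → Fin 4 → Fin 4 → Fin 4 → ℝ) (ε₁ ε₂ : ℝ)
    (K L : Matrix (Fin 4) (Fin 4) ℝ) : Prop :=
  K.IsSymm ∧ L.IsSymm ∧ ∀ a b c d, R a b c d =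
    ε₁ * (K a c * K b d - K a d * K b c) + ε₂ * (L a c * L b d - L a d * L b c)

end RiemGeom

/-- The total space of the tautological line bundle `O(-1)` over the complex projective line: pairs
consisting of a line in `ℂ²` through the origin and a vector on that line. -/
structure TautBundle where
  line : ℙ ℂ (Fin 2 → ℂ)
  vec : Fin 2 → ℂ
  mem : vec ∈ line.submodule

namespace TautBundle

/-- The vector `(1, w)` (for `i = 0`) or `(w, 1)` (for `i = 1`). -/
def affineVec (i : Fin 2) (w : ℂ) : Fin 2 → ℂ := fun k => if k = i then 1 else w

theorem affineVec_ne_zero (i : Fin 2) (w : ℂ) : affineVec i w ≠ 0 := fun h => by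
  have := congrFun h i
  simp [affineVec] at this

/-- The inverse of the standard chart number `i`: it sends `(l, w)` to the point `l (1, w)` of the
line `[1 : w]` for `i = 0`, and to the point `l (w, 1)` of the line `[w : 1]` for `i = 1`. -/
def ofChart (i : Fin 2) (x : ℂ × ℂ) : TautBundle where
  line := Projectivization.mk ℂ (affineVec i x.2) (affineVec_ne_zero i x.2)
  vec := x.1 • affineVec i x.2
  mem := by
    rw [Projectivization.submodule_mk]
    exact Submodule.smul_mem _ _ (Submodule.mem_span_singleton_self _)

theorem ofChart_rep (i : Fin 2) (x : ℂ × ℂ) :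
    ∃ a : ℂ, a ≠ 0 ∧ ∀ k, (ofChart i x).line.rep k = a * affineVec i x.2 k := by
  obtain ⟨a, ha⟩ := Projectivization.exists_smul_eq_mk_rep ℂ (affineVec i x.2)
    (affineVec_ne_zero i x.2)
  refine ⟨a, a.ne_zero, fun k => ?_⟩
  change (Projectivization.mk ℂ (affineVec i x.2) (affineVec_ne_zero i x.2)).rep k = _
  rw [← ha]
  rfl

theorem ext_of_rep {p q : TautBundle} (a : ℂ) (h : ∀ k, p.line.rep k = a * q.line.rep k)
    (hv : p.vec = q.vec) : p = q := by
  have hl : p.line = q.line := by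
    rw [← p.line.mk_rep, ← q.line.mk_rep, Projectivization.mk_eq_mk_iff']
    exact ⟨a, funext fun k => (h k).symm⟩
  cases p
  cases q
  simp_all

/-- The standard chart number `i` of the total space, defined over the lines whose `i`-th
homogeneous coordinate does not vanish: the fibre coordinate is the `i`-th coordinate of the
vector, the base coordinate is the affine coordinate on the projective line. -/
def chart (i : Fin 2) : PartialEquiv TautBundle (ℂ × ℂ) where
  toFun p := (p.vec i, p.line.rep (1 - i) / p.line.rep i)
  invFun := ofChart i
  source := {p | p.line.rep i ≠ 0}
  target := Set.univ
  map_source' := fun _ _ => Set.mem_univ _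
  map_target' := fun x _ => by
    obtain ⟨a, ha, h⟩ := ofChart_rep i x
    simp [h, affineVec, ha]
  left_inv' := fun p (hp : p.line.rep i ≠ 0) => by
    obtain ⟨a, ha, h⟩ := ofChart_rep i (p.vec i, p.line.rep (1 - i) / p.line.rep i)
    have hm := p.mem
    rw [Projectivization.submodule_eq, Submodule.mem_span_singleton] at hm
    obtain ⟨c, hc⟩ := hm
    refine ext_of_rep (a / p.line.rep i) (fun k => ?_) (funext fun k => ?_)
    · rw [h]
      fin_cases i <;> fin_cases k <;> simp [affineVec] at hp ⊢ <;> field_simp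
    · rw [← hc]
      fin_cases i <;> fin_cases k <;> simp [affineVec, ofChart] at hp ⊢ <;> field_simp
  right_inv' := fun x _ => by
    obtain ⟨a, ha, h⟩ := ofChart_rep i x
    refine Prod.ext ?_ ?_
    · simp [ofChart, affineVec]
    · simp only [h]
      fin_cases i <;> simp [affineVec] <;> field_simp

/-- The change of coordinates from one of the two charts to the other. -/
def swapCoord (x : ℂ × ℂ) : ℂ × ℂ := (x.1 * x.2, x.2⁻¹)

theorem chart_apply_ofChart_self (i : Fin 2) (x : ℂ × ℂ) : chart i (ofChart i x) = x :=
  (chart i).right_inv (Set.mem_univ _)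

theorem chart_apply_ofChart_of_ne {i j : Fin 2} (hij : i ≠ j) (x : ℂ × ℂ) :
    chart j (ofChart i x) = swapCoord x := by
  obtain ⟨a, ha, h⟩ := ofChart_rep i x
  change ((ofChart i x).vec j, (ofChart i x).line.rep (1 - j) / (ofChart i x).line.rep j) = _
  simp only [h, swapCoord]
  fin_cases i <;> fin_cases j <;> simp [affineVec, ofChart] at hij ⊢ <;> field_simp

theorem transition_source_of_ne {i j : Fin 2} (hij : i ≠ j) :
    ((chart i).symm.trans (chart j)).source = {x | x.2 ≠ 0} := by
  ext x
  obtain ⟨a, ha, h⟩ := ofChart_rep i x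
  have : x ∈ ((chart i).symm.trans (chart j)).source ↔ (ofChart i x).line.rep j ≠ 0 := by
    simp [chart, PartialEquiv.trans_source]
  rw [this, h]
  fin_cases i <;> fin_cases j <;> simp [affineVec, ha] at hij ⊢

theorem transition_source_self (i : Fin 2) :
    ((chart i).symm.trans (chart i)).source = Set.univ := by
  ext x
  obtain ⟨a, ha, h⟩ := ofChart_rep i x
  have : x ∈ ((chart i).symm.trans (chart i)).source ↔ (ofChart i x).line.rep i ≠ 0 := by
    simp [chart, PartialEquiv.trans_source]
  rw [this, h]
  simp [affineVec, ha]

theorem isOpen_snd_ne_zero : IsOpen {x : ℂ × ℂ | x.2 ≠ 0} :=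
  isOpen_ne_fun continuous_snd continuous_const

theorem contDiffOn_swapCoord (𝕜 : Type*) [NontriviallyNormedField 𝕜] [NormedAlgebra 𝕜 ℂ]
    (n : WithTop ℕ∞) : ContDiffOn 𝕜 n swapCoord {x | x.2 ≠ 0} := by
  refine ContDiffOn.prodMk (contDiff_fst.mul contDiff_snd).contDiffOn ?_
  exact contDiff_snd.contDiffOn.inv fun x hx => hx

theorem contDiffOn_transition (𝕜 : Type*) [NontriviallyNormedField 𝕜] [NormedAlgebra 𝕜 ℂ]
    (n : WithTop ℕ∞) (i j : Fin 2) :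
    ContDiffOn 𝕜 n ((chart i).symm.trans (chart j)) ((chart i).symm.trans (chart j)).source := by
  by_cases hij : i = j
  · subst hij
    exact contDiffOn_id.congr fun x _ => chart_apply_ofChart_self i x
  · rw [transition_source_of_ne hij]
    exact (contDiffOn_swapCoord 𝕜 n).congr fun x _ => chart_apply_ofChart_of_ne hij x

/-- The index of the preferred chart at a point. -/
def chartIndex (p : TautBundle) : Fin 2 := open Classical in if p.line.rep 0 ≠ 0 then 0 else 1

theorem rep_chartIndex_ne_zero (p : TautBundle) : p.line.rep p.chartIndex ≠ 0 := by
  unfold chartIndex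
  split_ifs with h
  · exact h
  · intro h1
    apply p.line.rep_nonzero
    push Not at h
    funext k
    fin_cases k
    · exact h
    · exact h1

/-- The two standard charts form an atlas. -/
def core : ChartedSpaceCore (ℂ × ℂ) TautBundle where
  atlas := Set.range chart
  chartAt p := chart p.chartIndex
  mem_chart_source p := p.rep_chartIndex_ne_zero
  chart_mem_atlas p := ⟨_, rfl⟩
  open_source := by
    rintro _ _ ⟨i, rfl⟩ ⟨j, rfl⟩
    by_cases hij : i = j
    · subst hij
      rw [transition_source_self]
      exact isOpen_univ
    · rw [transition_source_of_ne hij]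
      exact isOpen_snd_ne_zero
  continuousOn_toFun := by
    rintro _ _ ⟨i, rfl⟩ ⟨j, rfl⟩
    exact (contDiffOn_transition ℂ 0 i j).continuousOn

instance : TopologicalSpace TautBundle := core.toTopologicalSpace

instance : ChartedSpace (ℂ × ℂ) TautBundle := core.toChartedSpace

theorem isManifold (𝕜 : Type*) [NontriviallyNormedField 𝕜] [NormedAlgebra 𝕜 ℂ]
    (n : WithTop ℕ∞) : IsManifold 𝓘(𝕜, ℂ × ℂ) n TautBundle := by
  refine isManifold_of_contDiffOn _ _ _ fun e e' he he' => ?_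
  simp only [atlas, core, ChartedSpace.atlas, Set.mem_iUnion] at he he'
  obtain ⟨_, ⟨i, rfl⟩, rfl⟩ := he
  obtain ⟨_, ⟨j, rfl⟩, rfl⟩ := he'
  have h := contDiffOn_transition 𝕜 n i j
  simp only [modelWithCornersSelf_coe, modelWithCornersSelf_coe_symm, Set.range_id,
    Set.inter_univ, Set.preimage_id, Function.id_comp, Function.comp_id]
  exact h

/-- The total space is a complex surface. -/
instance : IsManifold 𝓘(ℂ, ℂ × ℂ) ω TautBundle := isManifold ℂ ω

/-- The total space is a smooth real four-manifold. -/
instance : IsManifold 𝓘(ℝ, ℂ × ℂ) ∞ TautBundle := isManifold ℝ ∞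

end TautBundle

namespace TautBundle

/-- The derivative of `(l, w) ↦ l * w`. -/
def prodDeriv (x : ℂ × ℂ) : ℂ × ℂ →L[ℝ] ℂ :=
  x.2 • ContinuousLinearMap.fst ℝ ℂ ℂ + x.1 • ContinuousLinearMap.snd ℝ ℂ ℂ

/-- The Burns metric in either of the two standard charts, with fibre coordinate `l` and base
coordinate `w`: it is `|dl|² + |d(l w)|² + |dw|² / (1 + |w|²)²`, that is, the pull-back of the flat
metric of `ℂ²` plus the metric of the round sphere of radius `1/2`. -/
def burnsForm (x : ℂ × ℂ) : ℂ × ℂ →L[ℝ] ℂ × ℂ →L[ℝ] ℝ :=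
  (innerSL ℝ).bilinearComp (ContinuousLinearMap.fst ℝ ℂ ℂ) (ContinuousLinearMap.fst ℝ ℂ ℂ)
    + (innerSL ℝ).bilinearComp (prodDeriv x) (prodDeriv x)
    + ((1 + ‖x.2‖ ^ 2) ^ 2)⁻¹ •
      (innerSL ℝ).bilinearComp (ContinuousLinearMap.snd ℝ ℂ ℂ) (ContinuousLinearMap.snd ℝ ℂ ℂ)

theorem burnsForm_apply (x u v : ℂ × ℂ) : burnsForm x u v =
    inner ℝ u.1 v.1 + inner ℝ (x.2 * u.1 + x.1 * u.2) (x.2 * v.1 + x.1 * v.2)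
      + ((1 + ‖x.2‖ ^ 2) ^ 2)⁻¹ * inner ℝ u.2 v.2 := by
  simp [burnsForm, prodDeriv, Complex.inner]
  ring

theorem contDiff_burnsForm : ContDiff ℝ ∞ burnsForm := by
  refine contDiff_clm_apply_iff.mpr fun u => contDiff_clm_apply_iff.mpr fun v => ?_
  simp only [burnsForm_apply]
  have h1 : ContDiff ℝ ∞ fun x : ℂ × ℂ => x.1 := contDiff_fst
  have h2 : ContDiff ℝ ∞ fun x : ℂ × ℂ => x.2 := contDiff_snd
  have hp : ∀ t : ℂ × ℂ, ContDiff ℝ ∞ fun x : ℂ × ℂ => x.2 * t.1 + x.1 * t.2 := fun t =>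
    (h2.mul contDiff_const).add (h1.mul contDiff_const)
  refine (contDiff_const.add ((hp u).inner ℝ (hp v))).add (ContDiff.mul ?_ contDiff_const)
  refine ContDiff.inv ((contDiff_const.add (h2.norm_sq ℝ)).pow 2) fun x => ?_
  positivity

theorem burnsForm_symm (x u v : ℂ × ℂ) : burnsForm x u v = burnsForm x v u := by
  simp only [burnsForm_apply, real_inner_comm]

theorem burnsForm_pos (x u : ℂ × ℂ) (hu : u ≠ 0) : 0 < burnsForm x u u := by
  rw [burnsForm_apply]
  simp only [real_inner_self_eq_norm_sq]
  by_cases h : u.1 = 0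
  · have h2 : u.2 ≠ 0 := fun h2 => hu (Prod.ext h h2)
    have := norm_pos_iff.mpr h2
    positivity
  · have := norm_pos_iff.mpr h
    positivity

/-- The derivative of the change of coordinates. -/
theorem hasFDerivAt_swapCoord (x : ℂ × ℂ) (hx : x.2 ≠ 0) :
    HasFDerivAt swapCoord ((prodDeriv x).prod
      ((-(x.2 ^ 2)⁻¹) • ContinuousLinearMap.snd ℝ ℂ ℂ)) x := by
  refine HasFDerivAt.prodMk ?_ ?_
  · refine ((hasFDerivAt_fst (𝕜 := ℝ) (p := x)).mul
      (hasFDerivAt_snd (𝕜 := ℝ) (p := x))).congr_fderiv ?_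
    ext u <;> simp [prodDeriv]
  · have := (hasDerivAt_inv hx).hasFDerivAt.restrictScalars ℝ
    refine (this.comp x (hasFDerivAt_snd (𝕜 := ℝ) (p := x))).congr_fderiv ?_
    ext u <;> simp [mul_comm]

/-- The chart expressions of the Burns metric are compatible. -/
theorem burnsForm_swapCoord (x u v : ℂ × ℂ) (hx : x.2 ≠ 0) :
    burnsForm (swapCoord x) (prodDeriv x u, -(x.2 ^ 2)⁻¹ * u.2)
      (prodDeriv x v, -(x.2 ^ 2)⁻¹ * v.2) = burnsForm x u v := by
  rw [burnsForm_apply, burnsForm_apply]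
  have key : ∀ t : ℂ × ℂ, x.2⁻¹ * (x.2 * t.1 + x.1 * t.2) + x.1 * x.2 * (-(x.2 ^ 2)⁻¹ * t.2)
      = t.1 := fun t => by field_simp; ring
  have hn : ‖x.2‖ ≠ 0 := norm_ne_zero_iff.mpr hx
  have h3 : ∀ c a b : ℂ, inner ℝ (c * a) (c * b) = ‖c‖ ^ 2 * inner ℝ a b := fun c a b => by
    simp only [Complex.inner, map_mul, Complex.sq_norm, Complex.normSq_apply, Complex.mul_re,
      Complex.mul_im, Complex.conj_re, Complex.conj_im]
    ring
  have e : ∀ t : ℂ × ℂ, prodDeriv x t = x.2 * t.1 + x.1 * t.2 := fun t => by simp [prodDeriv]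
  simp only [e, swapCoord, key, h3, norm_neg, norm_inv, norm_pow]
  field_simp
  ring

theorem coe_chartAt (p : TautBundle) : ⇑(chartAt (ℂ × ℂ) p) = chart p.chartIndex := rfl

theorem coe_chartAt_symm (p : TautBundle) :
    ⇑(chartAt (ℂ × ℂ) p).symm = ofChart p.chartIndex := rfl

theorem mem_chartAt_source (p q : TautBundle) :
    q ∈ (chartAt (ℂ × ℂ) p).source ↔ q.line.rep p.chartIndex ≠ 0 := Iff.rfl

/-- The Burns metric read in the standard chart `i` is `burnsForm`, whichever chart is the preferred
one at the point. -/
theorem burnsForm_coordChange (p q : TautBundle) (hq : q ∈ (chartAt (ℂ × ℂ) p).source)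
    (u v : ℂ × ℂ) :
    burnsForm (chartAt (ℂ × ℂ) q q)
      ((tangentBundleCore 𝓘(ℝ, ℂ × ℂ) TautBundle).coordChange (achart (ℂ × ℂ) p)
        (achart (ℂ × ℂ) q) q u)
      ((tangentBundleCore 𝓘(ℝ, ℂ × ℂ) TautBundle).coordChange (achart (ℂ × ℂ) p)
        (achart (ℂ × ℂ) q) q v)
    = burnsForm (chartAt (ℂ × ℂ) p q) u v := by
  rw [tangentBundleCore_coordChange_achart]
  simp only [extChartAt, OpenPartialHomeomorph.extend, modelWithCornersSelf_partialEquiv,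
    PartialEquiv.trans_refl, modelWithCornersSelf_coe, Set.range_id, fderivWithin_univ,
    OpenPartialHomeomorph.toFun_eq_coe, OpenPartialHomeomorph.coe_toPartialEquiv_symm, coe_chartAt,
    coe_chartAt_symm]
  set x := chart p.chartIndex q with hx
  have hqx : ofChart p.chartIndex x = q := (chart p.chartIndex).left_inv hq
  by_cases h : p.chartIndex = q.chartIndex
  · have e : chart q.chartIndex ∘ ofChart p.chartIndex = id := by
      rw [← h]
      exact funext fun y => chart_apply_ofChart_self _ y
    rw [e, fderiv_id, ← h]
    rfl
  · have e : chart q.chartIndex ∘ ofChart p.chartIndex = swapCoord :=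
      funext fun y => chart_apply_ofChart_of_ne h y
    have hx2 : x.2 ≠ 0 := by
      have : x ∈ ((chart p.chartIndex).symm.trans (chart q.chartIndex)).source := by
        refine ⟨Set.mem_univ _, ?_⟩
        change ofChart p.chartIndex x ∈ (chart q.chartIndex).source
        rw [hqx]
        exact q.rep_chartIndex_ne_zero
      rw [transition_source_of_ne h] at this
      exact this
    have eq : chart q.chartIndex q = swapCoord x := by
      rw [← chart_apply_ofChart_of_ne h x, hqx]
    rw [e, (hasFDerivAt_swapCoord x hx2).fderiv, eq]
    exact burnsForm_swapCoord x u v hx2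

theorem contMDiff_burnsForm : ContMDiff 𝓘(ℝ, ℂ × ℂ)
    (𝓘(ℝ, ℂ × ℂ).prod 𝓘(ℝ, ℂ × ℂ →L[ℝ] ℂ × ℂ →L[ℝ] ℝ)) ∞
    (fun p : TautBundle => Bundle.TotalSpace.mk' (ℂ × ℂ →L[ℝ] ℂ × ℂ →L[ℝ] ℝ)
      (E := fun p : TautBundle => TangentSpace 𝓘(ℝ, ℂ × ℂ) p →L[ℝ]
        TangentSpace 𝓘(ℝ, ℂ × ℂ) p →L[ℝ] ℝ) p (burnsForm (chartAt (ℂ × ℂ) p p))) := by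
  intro p
  rw [contMDiffAt_hom_bundle]
  refine ⟨contMDiffAt_id, ?_⟩
  have h1 : ContMDiffAt 𝓘(ℝ, ℂ × ℂ) 𝓘(ℝ, ℂ × ℂ →L[ℝ] ℂ × ℂ →L[ℝ] ℝ) ∞
      (fun q => burnsForm (chartAt (ℂ × ℂ) p q)) p := by
    have h2 : ContMDiffAt 𝓘(ℝ, ℂ × ℂ) 𝓘(ℝ, ℂ × ℂ) ∞ (chartAt (ℂ × ℂ) p) p :=
      contMDiffAt_extChartAt
    exact contDiff_burnsForm.contMDiff.contMDiffAt.comp p h2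
  refine h1.congr_of_eventuallyEq ?_
  filter_upwards [(chartAt (ℂ × ℂ) p).open_source.mem_nhds (mem_chart_source _ p)] with q hq
  refine ContinuousLinearMap.ext fun u => ContinuousLinearMap.ext fun v => ?_
  have hb : q ∈ (trivializationAt (ℂ × ℂ) (TangentSpace 𝓘(ℝ, ℂ × ℂ)) p).baseSet := hq
  have key := burnsForm_coordChange p q hq u v
  rw [← TangentBundle.symmL_trivializationAt_eq_core hq] at key
  refine (inCoordinates_apply_eq₂ hb hb (Set.mem_univ _)).trans (Eq.trans ?_ key)
  have hs : ∀ t : ℂ × ℂ, (trivializationAt (ℂ × ℂ) (TangentSpace 𝓘(ℝ, ℂ × ℂ)) p).symmL ℝ q t =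
      (trivializationAt (ℂ × ℂ) (TangentSpace 𝓘(ℝ, ℂ × ℂ)) p).symm q t := fun t =>
    Bundle.Trivialization.symmL_apply _ hb t
  refine (DFunLike.congr_fun (Bundle.Trivial.linearMapAt_trivialization ℝ TautBundle ℝ q) _).trans ?_
  exact congrArg₂ (fun a b => burnsForm (chartAt (ℂ × ℂ) q q) a b) (hs u).symm (hs v).symm

theorem isVonNBounded_burnsForm (x : ℂ × ℂ) :
    Bornology.IsVonNBounded ℝ {u : ℂ × ℂ | burnsForm x u u < 1} := by
  refine (NormedSpace.isVonNBounded_iff ℝ).mpr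
    ((Metric.isBounded_closedBall (x := (0 : ℂ × ℂ)) (r := 1 + ‖x.2‖ ^ 2)).subset ?_)
  intro u hu
  rw [Set.mem_ofPred_eq, burnsForm_apply] at hu
  simp only [real_inner_self_eq_norm_sq] at hu
  have hc : (0 : ℝ) < 1 + ‖x.2‖ ^ 2 := by positivity
  have h0 : 0 ≤ ‖x.2 * u.1 + x.1 * u.2‖ ^ 2 := by positivity
  have h2 : 0 ≤ ((1 + ‖x.2‖ ^ 2) ^ 2)⁻¹ * ‖u.2‖ ^ 2 := by positivity
  rw [mem_closedBall_zero_iff, Prod.norm_def]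
  refine max_le ?_ ?_
  · nlinarith [norm_nonneg u.1, sq_nonneg ‖x.2‖]
  · have h3 : ((1 + ‖x.2‖ ^ 2) ^ 2)⁻¹ * ‖u.2‖ ^ 2 ≤ 1 := by nlinarith [sq_nonneg ‖u.1‖]
    rw [inv_mul_le_iff₀ (by positivity), mul_one] at h3
    exact le_of_sq_le_sq h3 hc.le

/-- The Burns metric, a smooth Riemannian metric on the total space of `O(-1)`. -/
def burnsMetric : Bundle.ContMDiffRiemannianMetric 𝓘(ℝ, ℂ × ℂ) ∞ (ℂ × ℂ)
    (fun p : TautBundle => TangentSpace 𝓘(ℝ, ℂ × ℂ) p) where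
  inner p := burnsForm (chartAt (ℂ × ℂ) p p)
  symm _ u v := burnsForm_symm _ u v
  pos _ u hu := burnsForm_pos _ u hu
  isVonNBounded _ := isVonNBounded_burnsForm _
  contMDiff := contMDiff_burnsForm

end TautBundle

namespace TautBundle

/-- The radius `ρ = |z|` in `ℂ²`. -/
def rho (z : Fin 2 → ℂ) : ℝ := √(‖z 0‖ ^ 2 + ‖z 1‖ ^ 2)

/-- The one-form `dρ` on `ℂ²` minus the origin. -/
def dRho (z u : Fin 2 → ℂ) : ℝ := (star (z 0) * u 0 + star (z 1) * u 1).re / rho z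

/-- The forms `sigma1`, `sigma2`, `sigma3` are the `SU(2)`-invariant one-forms on `ℂ²` minus the
origin, that is on `(0, ∞) × SU(2)`, with `dσ₁ + σ₂ ∧ σ₃ = 0` and its cyclic permutations. -/
def sigma1 (z u : Fin 2 → ℂ) : ℝ := -(2 * (z 0 * u 1 - z 1 * u 0).re / rho z ^ 2)

/-- The invariant one-form `σ₂`, see `sigma1`. -/
def sigma2 (z u : Fin 2 → ℂ) : ℝ := -(2 * (z 0 * u 1 - z 1 * u 0).im / rho z ^ 2)

/-- The invariant one-form `σ₃`, see `sigma1`. -/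
def sigma3 (z u : Fin 2 → ℂ) : ℝ := -(2 * (star (z 0) * u 0 + star (z 1) * u 1).im / rho z ^ 2)

/-- The coordinate form `dρ² + ρ²/4 (σ₁² + σ₂² + σ₃²) + 1/4 (σ₁² + σ₂²)` of the Burns metric on `ℂ²`
minus the origin. -/
def bianchiForm (z u v : Fin 2 → ℂ) : ℝ :=
  dRho z u * dRho z v
    + rho z ^ 2 / 4 * (sigma1 z u * sigma1 z v + sigma2 z u * sigma2 z v + sigma3 z u * sigma3 z v)
    + 1 / 4 * (sigma1 z u * sigma1 z v + sigma2 z u * sigma2 z v)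

theorem bianchiForm_eq {z : Fin 2 → ℂ} (hz : z ≠ 0) (u v : Fin 2 → ℂ) :
    bianchiForm z u v = inner ℝ (u 0) (v 0) + inner ℝ (u 1) (v 1)
      + inner ℝ (z 0 * u 1 - z 1 * u 0) (z 0 * v 1 - z 1 * v 0)
        / (‖z 0‖ ^ 2 + ‖z 1‖ ^ 2) ^ 2 := by
  have hN : 0 < ‖z 0‖ ^ 2 + ‖z 1‖ ^ 2 := by
    by_contra h
    apply hz
    have h0 : ‖z 0‖ ^ 2 = 0 := by nlinarith [sq_nonneg ‖z 0‖, sq_nonneg ‖z 1‖]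
    have h1 : ‖z 1‖ ^ 2 = 0 := by nlinarith [sq_nonneg ‖z 0‖, sq_nonneg ‖z 1‖]
    funext k
    fin_cases k
    · simpa using h0
    · simpa using h1
  have hr : rho z ^ 2 = ‖z 0‖ ^ 2 + ‖z 1‖ ^ 2 := Real.sq_sqrt hN.le
  have hr0 : rho z ≠ 0 := by
    intro h
    rw [h] at hr
    linarith [hr]
  have hd : dRho z u * dRho z v = (star (z 0) * u 0 + star (z 1) * u 1).re *
      (star (z 0) * v 0 + star (z 1) * v 1).re / (‖z 0‖ ^ 2 + ‖z 1‖ ^ 2) := by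
    rw [← hr, dRho, dRho]
    field_simp
  unfold bianchiForm
  rw [hd]
  simp only [sigma1, sigma2, sigma3, hr]
  have hN' := hN.ne'
  field_simp
  simp only [Complex.inner, Complex.sq_norm, Complex.normSq_apply, Complex.mul_re, Complex.mul_im,
    Complex.add_re, Complex.add_im, Complex.sub_re, Complex.sub_im, Complex.star_def, Complex.conj_re,
    Complex.conj_im]
  ring

/-- The derivative of the blow-down map `(l, w) ↦ l (1, w)`, respectively `l (w, 1)`, in the chart
number `i`. -/
theorem hasFDerivAt_vec_ofChart (i : Fin 2) (x : ℂ × ℂ) :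
    HasFDerivAt (fun y => (ofChart i y).vec) (ContinuousLinearMap.pi fun k =>
      if k = i then ContinuousLinearMap.fst ℝ ℂ ℂ else prodDeriv x) x := by
  refine hasFDerivAt_pi.mpr fun k => ?_
  by_cases hk : k = i
  · simp only [ofChart, affineVec, Pi.smul_apply, smul_eq_mul, hk, if_true, mul_one]
    exact hasFDerivAt_fst
  · simp only [ofChart, affineVec, Pi.smul_apply, smul_eq_mul, hk, if_false]
    refine ((hasFDerivAt_fst (𝕜 := ℝ) (p := x)).mul
      (hasFDerivAt_snd (𝕜 := ℝ) (p := x))).congr_fderiv ?_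
    ext u <;> simp [prodDeriv]

theorem hasMFDerivAt_vec (p : TautBundle) :
    HasMFDerivAt 𝓘(ℝ, ℂ × ℂ) 𝓘(ℝ, Fin 2 → ℂ) vec p (ContinuousLinearMap.pi fun k =>
      if k = p.chartIndex then ContinuousLinearMap.fst ℝ ℂ ℂ
        else prodDeriv (chartAt (ℂ × ℂ) p p)) := by
  have h := hasFDerivAt_vec_ofChart p.chartIndex (chartAt (ℂ × ℂ) p p)
  refine ⟨?_, h.hasFDerivWithinAt⟩
  have h1 : ContinuousAt (chartAt (ℂ × ℂ) p) p :=
    (chartAt (ℂ × ℂ) p).continuousAt (mem_chart_source _ p)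
  have h2 : ContinuousAt (fun q => (ofChart p.chartIndex (chartAt (ℂ × ℂ) p q)).vec) p :=
    ContinuousAt.comp (f := chartAt (ℂ × ℂ) p) h.continuousAt h1
  refine h2.congr ?_
  filter_upwards [(chartAt (ℂ × ℂ) p).open_source.mem_nhds (mem_chart_source _ p)] with q hq
  exact congrArg vec ((chartAt (ℂ × ℂ) p).left_inv hq)

theorem burnsForm_eq_bianchiForm (i : Fin 2) (x u v : ℂ × ℂ) (hx : x.1 ≠ 0) :
    burnsForm x u v = bianchiForm (ofChart i x).vec
      (fun k => if k = i then u.1 else prodDeriv x u)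
      (fun k => if k = i then v.1 else prodDeriv x v) := by
  have hp : (ofChart i x).vec ≠ 0 := by
    intro h
    have := congrFun h i
    simp [ofChart, affineVec, hx] at this
  have e : ∀ t : ℂ × ℂ, prodDeriv x t = x.2 * t.1 + x.1 * t.2 := fun t => by simp [prodDeriv]
  have h3 : ∀ c a b : ℂ, inner ℝ (c * a) (c * b) = ‖c‖ ^ 2 * inner ℝ a b := fun c a b => by
    simp only [Complex.inner, map_mul, Complex.sq_norm, Complex.normSq_apply, Complex.mul_re,
      Complex.mul_im, Complex.conj_re, Complex.conj_im]
    ring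
  have hn : ‖x.1‖ ≠ 0 := norm_ne_zero_iff.mpr hx
  have hw : 1 + ‖x.2‖ ^ 2 ≠ 0 := by positivity
  have k1 : ∀ t : ℂ × ℂ, x.1 * (x.2 * t.1 + x.1 * t.2) - x.1 * x.2 * t.1 = x.1 ^ 2 * t.2 :=
    fun t => by ring
  have k2 : ∀ t : ℂ × ℂ, x.1 * x.2 * t.1 - x.1 * (x.2 * t.1 + x.1 * t.2) = x.1 ^ 2 * (-t.2) :=
    fun t => by ring
  have hN : ∀ a : ℝ, ‖x.1 ^ 2‖ ^ 2 * a / (‖x.1‖ ^ 2 + ‖x.1 * x.2‖ ^ 2) ^ 2 =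
      ((1 + ‖x.2‖ ^ 2) ^ 2)⁻¹ * a := fun a => by
    rw [norm_mul, norm_pow]
    have : ‖x.1‖ ^ 2 + (‖x.1‖ * ‖x.2‖) ^ 2 = ‖x.1‖ ^ 2 * (1 + ‖x.2‖ ^ 2) := by ring
    rw [this]
    field_simp
  have hv : ∀ k, (ofChart i x).vec k = x.1 * (if k = i then 1 else x.2) := fun _ => rfl
  rw [burnsForm_apply, bianchiForm_eq hp]
  simp only [hv, e]
  fin_cases i
  · simp only [Fin.zero_eta, Fin.isValue, if_true, one_ne_zero, if_false, mul_one, k1, h3]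
    rw [hN]
  · simp only [Fin.mk_one, Fin.isValue, if_true, zero_ne_one, if_false, mul_one, k2, h3,
      inner_neg_neg]
    rw [add_comm (‖x.1 * x.2‖ ^ 2), hN]
    ring

/-- Off the zero section the Burns metric is the pull-back of its coordinate form by the blow-down
map. -/
theorem burnsMetric_eq_bianchiForm (p : TautBundle) (hp : p.vec ≠ 0)
    (u v : TangentSpace 𝓘(ℝ, ℂ × ℂ) p) :
    burnsMetric.inner p u v = bianchiForm p.vec
      (mfderiv 𝓘(ℝ, ℂ × ℂ) 𝓘(ℝ, Fin 2 → ℂ) vec p u)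
      (mfderiv 𝓘(ℝ, ℂ × ℂ) 𝓘(ℝ, Fin 2 → ℂ) vec p v) := by
  have hq : (ofChart p.chartIndex (chartAt (ℂ × ℂ) p p)).vec = p.vec :=
    congrArg vec ((chartAt (ℂ × ℂ) p).left_inv (mem_chart_source _ p))
  have hx : (chartAt (ℂ × ℂ) p p).1 ≠ 0 := by
    intro h
    apply hp
    rw [← hq]
    simp [ofChart, h]
  have hd : ∀ t : ℂ × ℂ, mfderiv 𝓘(ℝ, ℂ × ℂ) 𝓘(ℝ, Fin 2 → ℂ) vec p t = fun k =>
      if k = p.chartIndex then t.1 else prodDeriv (chartAt (ℂ × ℂ) p p) t := fun t => by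
    rw [(hasMFDerivAt_vec p).mfderiv]
    funext k
    change (if k = p.chartIndex then ContinuousLinearMap.fst ℝ ℂ ℂ
      else prodDeriv (chartAt (ℂ × ℂ) p p)) t = _
    split_ifs <;> rfl
  have key := burnsForm_eq_bianchiForm p.chartIndex (chartAt (ℂ × ℂ) p p) u v hx
  rw [hq] at key
  exact key.trans (congrArg₂ (bianchiForm p.vec) (hd u).symm (hd v).symm)

end TautBundle

end

/-! The metric is the pull-back of the flat metric of ℂ² under the blow-down map plus the pull-back
of the round metric of a sphere of radius 1/2 under the projection to the line. Pairing the
blow-down map with the Hopf identification of ℂP¹ with that sphere therefore gives an isometric map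
into ℝ⁴ × ℝ³. It is an embedding because both charts can be recovered continuously from its
coordinates (`isEmbedding_embed`), so the class is at most 3.

For the lower bound, suppose codimension two is possible. The Gauss equation
(`riemannCoord_induced`), with the form on the normal space diagonalised, writes the curvature as a
combination of the Kulkarni-Nomizu squares of two symmetric matrices `K`, `L`. Up to scale such a
square is Λ²K, and Λ²K ∗ Λ²K = det K ∗. Hence P = X + Y, where X and Y are multiples of ∗Λ²K and
∗Λ²L. These have scalar squares, and by the first Bianchi identity their contractions vanish, which
makes them self-adjoint for the wedge product.

In a unitary coframe ξ, η the curvature of the Burns metric is, up to a positive factor depending on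
the point, the fixed tensor `burnsCurv`, built from |η|² and from the real and imaginary parts of
the symmetrised product ξη (`riemannCoord_burnsForm_eq`). So every pointwise claim reduces to one 6
× 6 matrix. Up to scale P consists of a Jordan block of size two with eigenvalue -8 and two blocks
with eigenvalues 8 and 0. The traces of its odd powers vanish, so Φ₃ and Φ₅ see no obstruction. The
nilpotent part of the Jordan block is the obstruction: X² = c and (P - X)² = d give PX + XP = P² + c
- d, which forces X to be half of P on that block, and self-adjointness then turns one off-diagonal
entry of X² = c into -64 minus a sum of real squares being zero (`not_sum_of_sq_scalar`).
Scalar-flatness is the vanishing of the trace of the same model tensor. -/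

noncomputable section

namespace RiemGeom

open Matrix

/-! Endomorphisms of the two-forms of a four-dimensional space, as `6 × 6` matrices -/

/-- An ordering of the pairs of indices `a < b`. -/
def basisPair : Fin 6 → Fin 4 × Fin 4 := ![(0, 1), (2, 3), (0, 2), (1, 3), (0, 3), (1, 2)]

/-- The matrix of an endomorphism of the two-forms in the basis `basisPair`. -/
def compress (T : PairMatrix) : Matrix (Fin 6) (Fin 6) ℝ :=
  Matrix.of fun k l => 2 * T (basisPair k) (basisPair l)

theorem IsFormEndo.diag_left {T : PairMatrix} (h : IsFormEndo T) (a : Fin 4) (J : Fin 4 × Fin 4) :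
    T (a, a) J = 0 := by
  linarith [h.1 a a J]

theorem IsFormEndo.diag_right {T : PairMatrix} (h : IsFormEndo T) (I : Fin 4 × Fin 4) (c : Fin 4) :
    T I (c, c) = 0 := by
  linarith [h.2 I c c]

theorem IsFormEndo.mul {S T : PairMatrix} (hS : IsFormEndo S) (hT : IsFormEndo T) :
    IsFormEndo (S * T) := by
  refine ⟨fun a b J => ?_, fun I c d => ?_⟩
  · simp only [mul_apply, hS.1 a b, neg_mul, Finset.sum_neg_distrib]
  · simp only [mul_apply, hT.2 _ c d, mul_neg, Finset.sum_neg_distrib]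

theorem IsFormEndo.smul {T : PairMatrix} (hT : IsFormEndo T) (t : ℝ) : IsFormEndo (t • T) := by
  refine ⟨fun a b J => ?_, fun I c d => ?_⟩
  · simp only [Matrix.smul_apply, hT.1 a b, smul_neg]
  · simp only [Matrix.smul_apply, hT.2 _ c d, smul_neg]

theorem IsFormEndo.add {S T : PairMatrix} (hS : IsFormEndo S) (hT : IsFormEndo T) :
    IsFormEndo (S + T) := by
  refine ⟨fun a b J => ?_, fun I c d => ?_⟩
  · simp only [Matrix.add_apply, hS.1 a b, hT.1 a b]
    ring
  · simp only [Matrix.add_apply, hS.2 _ c d, hT.2 _ c d]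
    ring

theorem isFormEndo_formId : IsFormEndo formId := by
  refine ⟨fun a b J => ?_, fun I c d => ?_⟩
  · simp only [formId, of_apply, and_comm (a := b = _)]
    ring
  · simp only [formId, of_apply]
    ring

theorem sum_pair_of_skew (F : Fin 4 × Fin 4 → ℝ) (h : ∀ a b, F (a, b) = F (b, a))
    (h0 : ∀ a, F (a, a) = 0) : ∑ K, F K = 2 * ∑ k, F (basisPair k) := by
  rw [Fintype.sum_prod_type]
  simp only [Fin.sum_univ_four, Fin.sum_univ_six, h0, h 1 0, h 2 0, h 3 0, h 2 1, h 3 1, h 3 2,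
    basisPair]
  simp
  ring

/-- A product of pair matrices sums over ordered pairs, so each two-form counts twice. The factor 2
in `compress` absorbs this, and also sends `formId`, with its factor 1/2, to the identity. -/
theorem compress_mul {S T : PairMatrix} (hS : IsFormEndo S) (hT : IsFormEndo T) :
    compress (S * T) = compress S * compress T := by
  ext k l
  simp only [compress, of_apply, mul_apply]
  rw [sum_pair_of_skew (fun K => S (basisPair k) K * T K (basisPair l))
    (fun a b => by rw [hS.2 _ a b, hT.1 a b]; ring) (fun a => by rw [hT.diag_left]; ring),
    Finset.mul_sum, Finset.mul_sum]
  exact Finset.sum_congr rfl fun i _ => by ring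

theorem trace_eq_trace_compress {T : PairMatrix} (hT : IsFormEndo T) :
    T.trace = (compress T).trace := by
  simp only [Matrix.trace, diag_apply]
  rw [sum_pair_of_skew (fun K => T K K)
    (fun a b => by rw [hT.2 _ a b, hT.1 a b]; ring) (fun a => hT.diag_left a _), Finset.mul_sum]
  rfl

/-- Exponents start at one because the zeroth power is the identity on all pairs of indices, which
is not skew. -/
theorem compress_pow {T : PairMatrix} (hT : IsFormEndo T) (n : ℕ) :
    IsFormEndo (T ^ (n + 1)) ∧ compress (T ^ (n + 1)) = compress T ^ (n + 1) := by
  induction n with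
  | zero => simpa using hT
  | succ n ih => exact ⟨pow_succ T (n + 1) ▸ ih.1.mul hT,
      by rw [pow_succ, compress_mul ih.1 hT, ih.2, ← pow_succ]⟩

theorem compress_injective {S T : PairMatrix} (hS : IsFormEndo S) (hT : IsFormEndo T)
    (h : compress S = compress T) : S = T := by
  have h1 : ∀ k l, S (basisPair k) (basisPair l) = T (basisPair k) (basisPair l) := fun k l => by
    have := congrFun (congrFun h k) l
    simp only [compress, of_apply] at this
    linarith
  have h2 : ∀ k J, S (basisPair k) J = T (basisPair k) J := by
    rintro k ⟨c, d⟩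
    have e : ∀ {U : PairMatrix}, IsFormEndo U → ∀ I a, U I (a, a) = 0 := fun h => h.diag_right
    have a0 := h1 k 0
    have a1 := h1 k 1
    have a2 := h1 k 2
    have a3 := h1 k 3
    have a4 := h1 k 4
    have a5 := h1 k 5
    simp only [basisPair, Matrix.cons_val] at a0 a1 a2 a3 a4 a5 ⊢
    fin_cases c <;> fin_cases d <;>
      first
      | (rw [hS.diag_right, hT.diag_right])
      | assumption
      | (rw [hS.2, hT.2, neg_inj]; assumption)
  ext ⟨a, b⟩ J
  have a0 := h2 0 J
  have a1 := h2 1 J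
  have a2 := h2 2 J
  have a3 := h2 3 J
  have a4 := h2 4 J
  have a5 := h2 5 J
  simp only [basisPair, Matrix.cons_val] at a0 a1 a2 a3 a4 a5
  fin_cases a <;> fin_cases b <;>
      first
      | (rw [hS.diag_left, hT.diag_left])
      | assumption
      | (rw [hS.1, hT.1, neg_inj]; assumption)

theorem compress_formId : compress formId = 1 := by
  ext k l
  fin_cases k <;> fin_cases l <;> simp [compress, formId, basisPair, one_apply]

/-! The Hodge star -/

/-- The Levi-Civita symbol as a matrix indexed by pairs of indices. -/
def star4 : PairMatrix := Matrix.of fun I J => eps I.1 I.2 J.1 J.2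

/-- A tensor with four indices as a matrix indexed by pairs of indices. -/
def pairing (R : Fin 4 → Fin 4 → Fin 4 → Fin 4 → ℝ) : PairMatrix :=
  Matrix.of fun I J => R I.1 I.2 J.1 J.2

theorem pTensor_eq (R : Fin 4 → Fin 4 → Fin 4 → Fin 4 → ℝ) :
    pTensor R = (-(1 / 2) : ℝ) • (star4 * pairing R) := by
  ext I J
  simp [pTensor, star4, pairing, mul_apply, Fintype.sum_prod_type]

theorem isFormEndo_star4 : IsFormEndo star4 := by
  refine ⟨fun a b J => ?_, fun I c d => ?_⟩
  · simp only [star4, of_apply, eps]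
    rw [← Int.cast_neg]
    congr 1
    rw [show ((a : ℕ) : ℤ) - (b : ℕ) = -((b : ℕ) - (a : ℕ)) by ring, Int.sign_neg]
    ring
  · simp only [star4, of_apply, eps]
    rw [← Int.cast_neg]
    congr 1
    rw [show ((c : ℕ) : ℤ) - (d : ℕ) = -((d : ℕ) - (c : ℕ)) by ring, Int.sign_neg]
    ring

theorem sign_two : Int.sign 2 = 1 := rfl

theorem sign_three : Int.sign 3 = 1 := rfl

/-- Twice the Hodge star. The negative block comes from ε₀₂₁₃ = -1. -/
theorem compress_star4 : compress star4 =
    !![0, 2, 0, 0, 0, 0; 2, 0, 0, 0, 0, 0; 0, 0, 0, -2, 0, 0; 0, 0, -2, 0, 0, 0;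
      0, 0, 0, 0, 0, 2; 0, 0, 0, 0, 2, 0] := by
  ext k l
  fin_cases k <;> fin_cases l <;>
    simp [compress, star4, eps, basisPair, sign_two, sign_three, Int.sign_neg]

theorem sum_eps_mul (A : Matrix (Fin 4) (Fin 4) ℝ) :
    ∑ a, ∑ b, ∑ c, ∑ d, eps a b c d * (A a 0 * A b 1 * A c 2 * A d 3) = A.det := by
  simp [eps, sign_two, sign_three, Int.sign_neg, det_succ_row_zero, Fin.succAbove,
    Fin.sum_univ_succ]
  ring

/-- Let the columns of `I` be the basis vectors with indices `a'`, `b'`, `c'`, `d'`. Then `A * I`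
has the chosen columns of `A`, the determinant is multiplicative, and the Leibniz sum for `I`
collapses to a single symbol. -/
theorem sum_eps_mul_cols (A : Matrix (Fin 4) (Fin 4) ℝ) (a' b' c' d' : Fin 4) :
    ∑ a, ∑ b, ∑ c, ∑ d, eps a b c d * (A a a' * A b b' * A c c' * A d d')
      = A.det * eps a' b' c' d' := by
  obtain ⟨I, hI⟩ : ∃ I : Matrix (Fin 4) (Fin 4) ℝ,
      ∀ i j, I i j = if i = ![a', b', c', d'] j then 1 else 0 :=
    ⟨Matrix.of fun i j => if i = ![a', b', c', d'] j then 1 else 0, fun _ _ => rfl⟩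
  have i0 : ∀ i, I i 0 = if i = a' then 1 else 0 := fun i => hI i 0
  have i1 : ∀ i, I i 1 = if i = b' then 1 else 0 := fun i => hI i 1
  have i2 : ∀ i, I i 2 = if i = c' then 1 else 0 := fun i => hI i 2
  have i3 : ∀ i, I i 3 = if i = d' then 1 else 0 := fun i => hI i 3
  have h1 : ∀ i j, (A * I) i j = A i (![a', b', c', d'] j) := fun i j => by
    simp [mul_apply, hI]
  have h2 := sum_eps_mul (A * I)
  rw [det_mul, ← sum_eps_mul I] at h2
  have k0 : ∀ i, (A * I) i 0 = A i a' := fun i => h1 i 0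
  have k1 : ∀ i, (A * I) i 1 = A i b' := fun i => h1 i 1
  have k2 : ∀ i, (A * I) i 2 = A i c' := fun i => h1 i 2
  have k3 : ∀ i, (A * I) i 3 = A i d' := fun i => h1 i 3
  simp only [k0, k1, k2, k3, i0, i1, i2, i3] at h2
  rw [h2]
  simp only [mul_ite, mul_one, mul_zero, Finset.sum_ite_eq', Finset.mem_univ, if_true]

end RiemGeom

/-! ### Kulkarni-Nomizu squares and their behaviour under a change of basis -/

namespace RiemGeom

open Matrix
open scoped Kronecker

/-- The Kulkarni-Nomizu square of a bilinear form. -/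
def kn (S : Matrix (Fin 4) (Fin 4) ℝ) : PairMatrix :=
  Matrix.of fun I J => S I.1 J.1 * S I.2 J.2 - S I.1 J.2 * S I.2 J.1

theorem kronecker_mul_formId (S : Matrix (Fin 4) (Fin 4) ℝ) :
    (S ⊗ₖ S) * formId = (1 / 2 : ℝ) • kn S := by
  ext ⟨a, b⟩ ⟨c, d⟩
  simp only [mul_apply, Fintype.sum_prod_type, kroneckerMap_apply, formId, of_apply, kn,
    Matrix.smul_apply, smul_eq_mul, mul_div_assoc', mul_sub, ← Finset.sum_div,
    Finset.sum_sub_distrib, ite_and]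
  simp
  ring

theorem formId_mul_kronecker (S : Matrix (Fin 4) (Fin 4) ℝ) :
    formId * (S ⊗ₖ S) = (1 / 2 : ℝ) • kn S := by
  ext ⟨a, b⟩ ⟨c, d⟩
  simp only [mul_apply, Fintype.sum_prod_type, kroneckerMap_apply, formId, of_apply, kn,
    Matrix.smul_apply, smul_eq_mul, div_mul_eq_mul_div, sub_mul, ← Finset.sum_div,
    Finset.sum_sub_distrib, ite_and]
  simp
  ring

/-- Functoriality of Λ²: `kn S` is twice `S ⊗ₖ S` composed with the antisymmetriser `formId`, which
commutes with every Kronecker square. -/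
theorem kn_conj (O S : Matrix (Fin 4) (Fin 4) ℝ) :
    kn (O * S * Oᵀ) = (O ⊗ₖ O) * kn S * (O ⊗ₖ O)ᵀ := by
  have h : ∀ S : Matrix (Fin 4) (Fin 4) ℝ, kn S = (2 : ℝ) • ((S ⊗ₖ S) * formId) := fun S => by
    rw [kronecker_mul_formId, smul_smul]
    norm_num
  have hc : (Oᵀ ⊗ₖ Oᵀ) * formId = formId * (Oᵀ ⊗ₖ Oᵀ) := by
    rw [kronecker_mul_formId, formId_mul_kronecker]
  rw [h, h, ← kroneckerMap_transpose, mul_kronecker_mul, mul_kronecker_mul, Matrix.mul_assoc, hc]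
  simp only [Matrix.mul_smul, Matrix.smul_mul, Matrix.mul_assoc]

/-- The Levi-Civita symbol is a volume form, so a linear map scales it by the determinant. -/
theorem transpose_kronecker_mul_star4 (O : Matrix (Fin 4) (Fin 4) ℝ) :
    (O ⊗ₖ O)ᵀ * star4 * (O ⊗ₖ O) = O.det • star4 := by
  ext ⟨a, b⟩ ⟨c, d⟩
  rw [Matrix.smul_apply, star4, of_apply, smul_eq_mul, ← sum_eps_mul_cols O a b c d]
  simp only [mul_apply, Fintype.sum_prod_type, kroneckerMap_apply, of_apply, transpose_apply,
    Finset.sum_mul]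
  have hsw : ∀ F : Fin 4 → Fin 4 → Fin 4 → Fin 4 → ℝ, ∑ x, ∑ y, ∑ z, ∑ w, F z w x y =
      ∑ x, ∑ y, ∑ z, ∑ w, F x y z w := fun F => by
    simp only [Fin.sum_univ_four]
    ring
  rw [← hsw]
  refine Finset.sum_congr rfl fun _ _ => Finset.sum_congr rfl fun _ _ => Finset.sum_congr rfl
    fun _ _ => Finset.sum_congr rfl fun _ _ => ?_
  ring

/-! The Gauss equation in codimension two -/

theorem isFormEndo_kn (K : Matrix (Fin 4) (Fin 4) ℝ) : IsFormEndo (kn K) := by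
  refine ⟨fun a b J => ?_, fun I c d => ?_⟩
  · simp only [kn, of_apply]
    ring
  · simp only [kn, of_apply]
    ring

/-- This is the first Bianchi identity: in each term the symbol is skew in two indices that are
contracted with a symmetric `K`. -/
theorem star4_mul_contract (K : Matrix (Fin 4) (Fin 4) ℝ) (hK : K.IsSymm) (a c : Fin 4) :
    ∑ b, (star4 * kn K) (a, b) (c, b) = 0 := by
  have h : ∀ i j, K i j = K j i := fun i j => hK.apply j i
  simp only [mul_apply, Fintype.sum_prod_type, star4, of_apply, kn]
  fin_cases a <;>
  simp [Fin.sum_univ_four, eps, sign_two, sign_three, Int.sign_neg, h 1 0, h 2 0, h 3 0, h 2 1,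
    h 3 1, h 3 2] <;> fin_cases c <;> simp [h 1 0, h 2 0, h 3 0, h 2 1, h 3 1, h 3 2] <;> ring

/-- Laplace expansion gives Λ²K ∗ Λ²K = det K ∗ for symmetric `K`, and ∗² = 1. -/
theorem star4_mul_kn_sq (K : Matrix (Fin 4) (Fin 4) ℝ) (hK : K.IsSymm) :
    ∃ c : ℝ, (star4 * kn K) * (star4 * kn K) = c • formId := by
  have h : ∀ i j, K i j = K j i := fun i j => hK.apply j i
  have hF := isFormEndo_star4.mul (isFormEndo_kn K)
  -- After `compress`, `star4` is 2∗ and `kn K` is 2Λ²K, so the product is 4 ∗Λ²K and its square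
  -- carries the factor 16.
  refine ⟨16 * K.det, compress_injective (hF.mul hF) (isFormEndo_formId.smul _) ?_⟩
  have hs : compress ((16 * K.det) • formId) = (16 * K.det) • compress formId := by
    ext k l
    simp only [compress, of_apply, Matrix.smul_apply, smul_eq_mul]
    ring
  rw [hs, compress_formId, compress_mul hF hF, compress_mul isFormEndo_star4 (isFormEndo_kn K),
    compress_star4]
  ext k l
  simp only [mul_apply, compress, kn, of_apply, Fin.sum_univ_six, basisPair, Matrix.cons_val,
    Matrix.smul_apply, smul_eq_mul, one_apply]
  simp [det_succ_row_zero, Fin.succAbove, Fin.sum_univ_succ, h 1 0, h 2 0, h 3 0, h 2 1, h 3 1,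
    h 3 2]
  fin_cases k <;> fin_cases l <;> simp [h 1 0, h 2 0, h 3 0, h 2 1, h 3 1, h 3 2] <;> ring

end RiemGeom

/-! ### The model curvature operator and its algebraic obstruction -/

namespace RiemGeom

open Matrix
open scoped Kronecker

theorem compress_smul (t : ℝ) (T : PairMatrix) : compress (t • T) = t • compress T := by
  ext k l
  simp only [compress, of_apply, Matrix.smul_apply, smul_eq_mul]
  ring

theorem compress_add (S T : PairMatrix) : compress (S + T) = compress S + compress T := by
  ext k l
  simp only [compress, of_apply, Matrix.add_apply]
  ring

theorem compress_transpose (T : PairMatrix) : compress Tᵀ = (compress T)ᵀ := rfl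

/-- An endomorphism of the two-forms whose contraction vanishes is self-adjoint with respect to the
wedge product. -/
theorem star4_mul_isSymm {X : PairMatrix} (hX : IsFormEndo X)
    (h : ∀ a c, ∑ b, X (a, b) (c, b) = 0) : (compress star4 * compress X).IsSymm := by
  -- The wedge-skew endomorphisms of Λ² form so(3,3) ≅ sl(4), of dimension 15. The sixteen
  -- contractions detect this part together with the trace, so their vanishing kills it.
  have h' : ∀ a c, X (a, 0) (c, 0) + X (a, 1) (c, 1) + X (a, 2) (c, 2) + X (a, 3) (c, 3) = 0 :=
    fun a c => by rw [← h a c, Fin.sum_univ_four]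
  have h00 := h' 0 0
  have h01 := h' 0 1
  have h02 := h' 0 2
  have h03 := h' 0 3
  have h10 := h' 1 0
  have h11 := h' 1 1
  have h12 := h' 1 2
  have h13 := h' 1 3
  have h20 := h' 2 0
  have h21 := h' 2 1
  have h22 := h' 2 2
  have h23 := h' 2 3
  have h30 := h' 3 0
  have h31 := h' 3 1
  have h32 := h' 3 2
  have h33 := h' 3 3
  simp only [hX.diag_left, hX.diag_right, hX.1 1 0, hX.1 2 0, hX.1 3 0, hX.1 2 1, hX.1 3 1,
    hX.1 3 2, hX.2 _ 1 0, hX.2 _ 2 0, hX.2 _ 3 0, hX.2 _ 2 1, hX.2 _ 3 1, hX.2 _ 3 2, neg_neg]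
    at h00 h01 h02 h03 h10 h11 h12 h13 h20 h21 h22 h23 h30 h31 h32 h33
  rw [compress_star4]
  ext k l
  rw [transpose_apply, mul_apply, mul_apply, Fin.sum_univ_six, Fin.sum_univ_six]
  fin_cases k <;> fin_cases l <;> simp [compress, basisPair] <;> linarith

/-- The first summand of the curvature of the Burns metric in an adapted frame. -/
def burnsS : Matrix (Fin 4) (Fin 4) ℝ := !![0, 0, 0, 0; 0, 0, 0, 0; 0, 0, 1, 0; 0, 0, 0, 1]

/-- The second summand of the curvature of the Burns metric in an adapted frame. -/
def burnsA : Matrix (Fin 4) (Fin 4) ℝ := !![0, 0, 1, 0; 0, 0, 0, -1; 1, 0, 0, 0; 0, -1, 0, 0]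

/-- The third summand of the curvature of the Burns metric in an adapted frame. -/
def burnsB : Matrix (Fin 4) (Fin 4) ℝ := !![0, 0, 0, 1; 0, 0, 1, 0; 0, 1, 0, 0; 1, 0, 0, 0]

/-- The curvature tensor of the Burns metric in an adapted frame, up to a factor. -/
def burnsCurv : PairMatrix := (4 : ℝ) • kn burnsS + kn burnsA + kn burnsB

theorem isFormEndo_burnsCurv : IsFormEndo burnsCurv :=
  (((isFormEndo_kn _).smul _).add (isFormEndo_kn _)).add (isFormEndo_kn _)

/-- The normal form behind everything: a nontrivial Jordan block for -8 and two symmetric rank-one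
blocks with eigenvalues 8 and 0. -/
theorem compress_star4_mul_burnsCurv : compress (star4 * burnsCurv) =
    !![-8, 16, 0, 0, 0, 0; 0, -8, 0, 0, 0, 0; 0, 0, 4, 4, 0, 0; 0, 0, 4, 4, 0, 0;
      0, 0, 0, 0, 4, -4; 0, 0, 0, 0, -4, 4] := by
  have h : compress burnsCurv =
    !![0, -4, 0, 0, 0, 0; -4, 8, 0, 0, 0, 0; 0, 0, -2, -2, 0, 0; 0, 0, -2, -2, 0, 0;
      0, 0, 0, 0, -2, 2; 0, 0, 0, 0, 2, -2] := by
    ext k l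
    fin_cases k <;> fin_cases l <;>
      simp [compress, burnsCurv, kn, burnsS, burnsA, burnsB, basisPair] <;> norm_num
  rw [compress_mul isFormEndo_star4 isFormEndo_burnsCurv, compress_star4, h]
  ext k l
  fin_cases k <;> fin_cases l <;> simp [mul_apply, Fin.sum_univ_six] <;> norm_num

/-- The eigenvalues -8, -8, 8, 8, 0, 0 are symmetric about zero, so odd power sums cancel; the
Jordan block is invisible to traces. -/
theorem trace_star4_mul_burnsCurv_pow_three : ((star4 * burnsCurv) ^ 3).trace = 0 := by
  have h := compress_pow (isFormEndo_star4.mul isFormEndo_burnsCurv) 2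
  rw [trace_eq_trace_compress h.1, h.2, compress_star4_mul_burnsCurv, pow_succ, pow_succ, pow_one]
  simp [trace, Fin.sum_univ_six]
  norm_num

theorem trace_star4_mul_burnsCurv_pow_five : ((star4 * burnsCurv) ^ 5).trace = 0 := by
  have h := compress_pow (isFormEndo_star4.mul isFormEndo_burnsCurv) 4
  rw [trace_eq_trace_compress h.1, h.2, compress_star4_mul_burnsCurv]
  have h2 : (!![-8, 16, 0, 0, 0, 0; 0, -8, 0, 0, 0, 0; 0, 0, 4, 4, 0, 0; 0, 0, 4, 4, 0, 0;
      0, 0, 0, 0, 4, -4; 0, 0, 0, 0, -4, 4] : Matrix (Fin 6) (Fin 6) ℝ) ^ 2 =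
    !![64, -256, 0, 0, 0, 0; 0, 64, 0, 0, 0, 0; 0, 0, 32, 32, 0, 0; 0, 0, 32, 32, 0, 0;
      0, 0, 0, 0, 32, -32; 0, 0, 0, 0, -32, 32] := by
    ext k l
    fin_cases k <;> fin_cases l <;> simp [pow_two, mul_apply, Fin.sum_univ_six] <;> norm_num
  rw [show 4 + 1 = 2 * 2 + 1 from rfl, pow_succ, pow_mul, h2, pow_two]
  simp [trace, Fin.sum_univ_six]
  norm_num

/-- The operator `star4 * burnsCurv` is not the sum of two operators with scalar squares, one of
them self-adjoint with respect to the wedge product. -/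
theorem not_sum_of_sq_scalar (X : Matrix (Fin 6) (Fin 6) ℝ)
    (hs : (compress star4 * X).IsSymm) (c d : ℝ) (hX : X * X = c • 1)
    (hY : (compress (star4 * burnsCurv) - X) * (compress (star4 * burnsCurv) - X) = d • 1) :
    False := by
  have hs' := fun k l => congrFun (congrFun hs k) l
  have hX' := fun k l => congrFun (congrFun hX k) l
  set P := compress (star4 * burnsCurv) with hP
  -- Expanding (P - X)² turns the two quadratic conditions into one that is linear in `X`.
  have hPX : P * X + X * P = P * P + (c - d) • (1 : Matrix (Fin 6) (Fin 6) ℝ) := by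
    rw [sub_smul, ← hX, ← hY]
    noncomm_ring
  have hPX' := fun k l => congrFun (congrFun hPX k) l
  rw [hP, compress_star4_mul_burnsCurv] at hPX'
  rw [compress_star4] at hs'
  simp only [transpose_apply, mul_apply, Matrix.add_apply, Fin.sum_univ_six,
    Matrix.smul_apply, one_apply, smul_eq_mul] at hs' hX' hPX'
  have x01 := hX' 0 1
  have s02 := hs' 1 2
  have s03 := hs' 1 3
  have s04 := hs' 1 4
  have s05 := hs' 1 5
  have p22 := hPX' 2 2
  have p23 := hPX' 2 3
  have p32 := hPX' 3 2
  have p33 := hPX' 3 3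
  have p00 := hPX' 0 0
  have p10 := hPX' 1 0
  have p20 := hPX' 2 0
  have p30 := hPX' 3 0
  have p40 := hPX' 4 0
  have p50 := hPX' 5 0
  have p01 := hPX' 0 1
  have p11 := hPX' 1 1
  have p21 := hPX' 2 1
  have p31 := hPX' 3 1
  have p41 := hPX' 4 1
  have p51 := hPX' 5 1
  simp at x01 s02 s03 s04 s05 p22 p23 p32 p33 p00 p10 p20 p30 p40 p50 p01 p11 p21 p31 p41 p51
  -- Pair the block on indices 2, 3 with its kernel vector (1, -1): both the left side and P²
  -- contribute zero.
  have hcd : c - d = 0 := by linarith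
  -- On the Jordan block J the equation JX + XJ = J² has the unique solution J/2, since no two
  -- eigenvalues of J add to zero.
  have e10 : X 1 0 = 0 := by linarith
  have e00 : X 0 0 = -4 := by linarith
  have e11 : X 1 1 = -4 := by linarith
  have e01 : X 0 1 = 8 := by linarith
  -- Column 1 of `X` outside the Jordan block must lie in the eigenspace of P for 8. Wedge
  -- self-adjointness then determines row 0 from column 1, with a sign.
  have e31 : X 3 1 = X 2 1 := by linarith
  have e51 : X 5 1 = - X 4 1 := by linarith
  have e02 : X 0 2 = - X 2 1 := by linarith
  have e03 : X 0 3 = - X 2 1 := by linarith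
  have e04 : X 0 4 = - X 4 1 := by linarith
  have e05 : X 0 5 = X 4 1 := by linarith
  -- The entry (0, 1) of X² = c now reads -64 - 2 (X 2 1)² - 2 (X 4 1)² = 0, impossible over the
  -- reals.
  rw [e00, e01, e11, e31, e51, e02, e03, e04, e05] at x01
  nlinarith [sq_nonneg (X 2 1), sq_nonneg (X 4 1)]

end RiemGeom

/-! ### Transport of the obstruction to arbitrary orthonormal frames -/

namespace RiemGeom

open Matrix
open scoped Kronecker

theorem formId_mul_apply (T : PairMatrix) (a b : Fin 4) (J : Fin 4 × Fin 4) :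
    (formId * T) (a, b) J = (T (a, b) J - T (b, a) J) / 2 := by
  simp only [mul_apply, Fintype.sum_prod_type, formId, of_apply, div_mul_eq_mul_div, sub_mul,
    ← Finset.sum_div, Finset.sum_sub_distrib, ite_and]
  simp

theorem mul_formId_apply (T : PairMatrix) (I : Fin 4 × Fin 4) (c d : Fin 4) :
    (T * formId) I (c, d) = (T I (c, d) - T I (d, c)) / 2 := by
  simp only [mul_apply, Fintype.sum_prod_type, formId, of_apply, mul_div_assoc', mul_sub,
    ← Finset.sum_div, Finset.sum_sub_distrib, ite_and]
  simp

/-- `formId` is the projection onto two-forms. This form of skewness is easily carried through a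
conjugation. -/
theorem isFormEndo_iff (T : PairMatrix) :
    IsFormEndo T ↔ formId * T = T ∧ T * formId = T := by
  refine ⟨fun h => ⟨?_, ?_⟩, fun h => ⟨fun a b J => ?_, fun I c d => ?_⟩⟩
  · ext ⟨a, b⟩ J
    rw [formId_mul_apply]
    linarith [h.1 a b J]
  · ext I ⟨c, d⟩
    rw [mul_formId_apply]
    linarith [h.2 I c d]
  · have h1 := formId_mul_apply T a b J
    rw [h.1] at h1
    linarith
  · have h1 := mul_formId_apply T I c d
    rw [h.2] at h1
    linarith

theorem IsFormEndo.transpose {T : PairMatrix} (h : IsFormEndo T) : IsFormEndo Tᵀ :=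
  ⟨fun a b J => h.2 J a b, fun I c d => h.1 c d I⟩

theorem kronecker_orthogonal {O : Matrix (Fin 4) (Fin 4) ℝ} (hO : O * Oᵀ = 1) :
    (O ⊗ₖ O) * (O ⊗ₖ O)ᵀ = 1 := by
  rw [← kroneckerMap_transpose, ← mul_kronecker_mul, hO, one_kronecker_one]

theorem star4_mul_kronecker {O : Matrix (Fin 4) (Fin 4) ℝ} (hO : O * Oᵀ = 1) :
    star4 * (O ⊗ₖ O) = O.det • ((O ⊗ₖ O) * star4) := by
  rw [← Matrix.mul_smul, ← transpose_kronecker_mul_star4, ← Matrix.mul_assoc, ← Matrix.mul_assoc,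
    kronecker_orthogonal hO, Matrix.one_mul]

/-- Endomorphisms of the two-forms stay such under a change of frame. -/
theorem IsFormEndo.conj {T : PairMatrix} (h : IsFormEndo T) (O : Matrix (Fin 4) (Fin 4) ℝ) :
    IsFormEndo ((O ⊗ₖ O) * T * (O ⊗ₖ O)ᵀ) := by
  have hc : ∀ U : Matrix (Fin 4) (Fin 4) ℝ, formId * (U ⊗ₖ U) = (U ⊗ₖ U) * formId := fun U => by
    rw [kronecker_mul_formId, formId_mul_kronecker]
  rw [isFormEndo_iff] at h ⊢
  constructor
  · rw [← Matrix.mul_assoc, ← Matrix.mul_assoc, hc, Matrix.mul_assoc _ formId, h.1]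
  · rw [← kroneckerMap_transpose, Matrix.mul_assoc, ← hc, ← Matrix.mul_assoc, Matrix.mul_assoc _ T,
      h.2]

theorem conj_mul_conj {M : PairMatrix} (hM : Mᵀ * M = 1) (S T : PairMatrix) :
    (M * S * Mᵀ) * (M * T * Mᵀ) = M * (S * T) * Mᵀ := by
  calc (M * S * Mᵀ) * (M * T * Mᵀ) = M * S * (Mᵀ * M) * T * Mᵀ := by noncomm_ring
    _ = _ := by rw [hM]; noncomm_ring

theorem conj_formId {O : Matrix (Fin 4) (Fin 4) ℝ} (hO : O * Oᵀ = 1) :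
    (O ⊗ₖ O) * formId * (O ⊗ₖ O)ᵀ = formId := by
  rw [kronecker_mul_formId, ← formId_mul_kronecker, Matrix.mul_assoc, kronecker_orthogonal hO,
    Matrix.mul_one]

theorem trace_smul_conj_pow {M : PairMatrix} (hM : Mᵀ * M = 1) (t : ℝ) (T : PairMatrix) (n : ℕ)
    (h : (T ^ (n + 1)).trace = 0) : ((t • (M * T * Mᵀ)) ^ (n + 1)).trace = 0 := by
  have hp : (M * T * Mᵀ) ^ (n + 1) = M * T ^ (n + 1) * Mᵀ := by
    clear h
    induction n with
    | zero => simp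
    | succ n ih => rw [pow_succ, ih, conj_mul_conj hM, ← pow_succ]
  rw [smul_pow, hp, trace_smul, trace_mul_comm, ← Matrix.mul_assoc, hM, Matrix.one_mul, h,
    smul_zero]

/-- A curvature tensor that is a nonzero multiple of `burnsCurv` in some orthonormal frame. -/
def IsBurnsLike (R : Fin 4 → Fin 4 → Fin 4 → Fin 4 → ℝ) : Prop :=
  ∃ (t : ℝ) (O : Matrix (Fin 4) (Fin 4) ℝ), t ≠ 0 ∧ O * Oᵀ = 1 ∧
    pairing R = t • ((O ⊗ₖ O) * burnsCurv * (O ⊗ₖ O)ᵀ)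

/-- Moving `star4` past `O ⊗ₖ O` costs only `O.det`, which is nonzero and is absorbed into the
scale. Orientation thus plays no role. -/
theorem IsBurnsLike.exists_pTensor {R : Fin 4 → Fin 4 → Fin 4 → Fin 4 → ℝ} (h : IsBurnsLike R) :
    ∃ (t : ℝ) (O : Matrix (Fin 4) (Fin 4) ℝ), t ≠ 0 ∧ O * Oᵀ = 1 ∧
      pTensor R = t • ((O ⊗ₖ O) * (star4 * burnsCurv) * (O ⊗ₖ O)ᵀ) := by
  obtain ⟨t, O, ht, hO, hR⟩ := h
  have hd : O.det ≠ 0 := fun h0 => by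
    have := congrArg det hO
    rw [det_mul, h0, zero_mul, det_one] at this
    exact zero_ne_one this
  refine ⟨-(1 / 2) * (t * O.det), O, by simp [ht, hd], hO, ?_⟩
  rw [pTensor_eq, hR, Matrix.mul_smul, ← Matrix.mul_assoc, ← Matrix.mul_assoc,
    star4_mul_kronecker hO]
  simp only [Matrix.smul_mul, smul_smul, Matrix.mul_assoc]

theorem IsBurnsLike.trace_pTensor {R : Fin 4 → Fin 4 → Fin 4 → Fin 4 → ℝ} (h : IsBurnsLike R) :
    (pTensor R ^ 3).trace = 0 ∧ (pTensor R ^ 5).trace = 0 := by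
  obtain ⟨t, O, -, hO, hR⟩ := h.exists_pTensor
  have hM := mul_eq_one_comm.mp (kronecker_orthogonal hO)
  rw [hR]
  exact ⟨trace_smul_conj_pow hM t _ 2 trace_star4_mul_burnsCurv_pow_three,
    trace_smul_conj_pow hM t _ 4 trace_star4_mul_burnsCurv_pow_five⟩

/-- Conjugating by the inverse frame change and dividing by `t` carries a decomposition of P to one
of the model, which `not_sum_of_sq_scalar` excludes. -/
theorem IsBurnsLike.not_gaussSummands {R : Fin 4 → Fin 4 → Fin 4 → Fin 4 → ℝ}
    (h : IsBurnsLike R) :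
    ¬ ∃ X Y : PairMatrix, IsGaussSummand X ∧ IsGaussSummand Y ∧ pTensor R = X + Y := by
  rintro ⟨X, Y, ⟨hX, -, ⟨c, hc⟩, hXc⟩, ⟨hY, -, ⟨d, hd⟩, -⟩, hXY⟩
  obtain ⟨t, O, ht, hO, hR⟩ := h.exists_pTensor
  rw [hXY] at hR
  have hO' : Oᵀ * Oᵀᵀ = 1 := by
    rw [transpose_transpose]
    exact mul_eq_one_comm.mp hO
  have hM := kronecker_orthogonal hO
  have hM' := kronecker_orthogonal hO'
  have hMt : (Oᵀ ⊗ₖ Oᵀ) = (O ⊗ₖ O)ᵀ := (kroneckerMap_transpose ..).symm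
  set N : PairMatrix := Oᵀ ⊗ₖ Oᵀ with hN
  have hNN : Nᵀ * N = 1 := mul_eq_one_comm.mp hM'
  have hXX := conj_mul_conj hNN X X
  have hYY := conj_mul_conj hNN Y Y
  rw [hc, Matrix.mul_smul, Matrix.smul_mul, conj_formId hO'] at hXX
  rw [hd, Matrix.mul_smul, Matrix.smul_mul, conj_formId hO'] at hYY
  have hPN : N * X * Nᵀ + N * Y * Nᵀ = t • (star4 * burnsCurv) := by
    rw [← Matrix.add_mul, ← Matrix.mul_add, hR, hMt, transpose_transpose, Matrix.mul_smul,
      Matrix.smul_mul]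
    congr 1
    rw [← hMt]
    have : (O ⊗ₖ O) = Nᵀ := by rw [hMt, transpose_transpose]
    rw [this]
    calc N * (Nᵀ * (star4 * burnsCurv) * Nᵀᵀ) * Nᵀ
        = (N * Nᵀ) * (star4 * burnsCurv) * (N * Nᵀ) := by
          rw [transpose_transpose]; noncomm_ring
      _ = _ := by rw [hM', Matrix.one_mul, Matrix.mul_one]
  have fX := hX.conj Oᵀ
  have fY := hY.conj Oᵀ
  -- The contraction condition is turned into wedge self-adjointness in the original frame. Only
  -- this symmetry has to be transported.
  have hsym : (star4 * (N * X * Nᵀ)).IsSymm := by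
    have h0 : (star4 * X).IsSymm := by
      have f := isFormEndo_star4.mul hX
      refine compress_injective f.transpose f ?_
      rw [compress_transpose, compress_mul isFormEndo_star4 hX]
      exact star4_mul_isSymm hX hXc
    have h1 : star4 * (N * X * Nᵀ) = Oᵀ.det • (N * (star4 * X) * Nᵀ) := by
      rw [← Matrix.mul_assoc, ← Matrix.mul_assoc, star4_mul_kronecker hO']
      simp only [Matrix.smul_mul, Matrix.mul_assoc, hN]
    rw [h1, IsSymm, transpose_smul, transpose_mul, transpose_mul, h0.eq, transpose_transpose,
      ← Matrix.mul_assoc N]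
  have hsy : (compress star4 * compress (N * X * Nᵀ)).IsSymm := by
    rw [← compress_mul isFormEndo_star4 fX, IsSymm, ← compress_transpose, hsym.eq]
  have cXX := congrArg compress hXX
  have cYY := congrArg compress hYY
  rw [compress_mul fX fX, compress_smul, compress_formId] at cXX
  rw [compress_mul fY fY, compress_smul, compress_formId] at cYY
  have cP := congrArg compress hPN
  rw [compress_add, compress_smul] at cP
  have hYe : compress (star4 * burnsCurv) - t⁻¹ • compress (N * X * Nᵀ) =
      t⁻¹ • compress (N * Y * Nᵀ) := by
    rw [sub_eq_iff_eq_add', ← smul_add, cP, smul_smul, inv_mul_cancel₀ ht, one_smul]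
  refine not_sum_of_sq_scalar (t⁻¹ • compress (N * X * Nᵀ)) ?_ (t⁻¹ * t⁻¹ * c) (t⁻¹ * t⁻¹ * d) ?_ ?_
  · rw [Matrix.mul_smul, IsSymm, transpose_smul, hsy.eq]
  · rw [Matrix.smul_mul, Matrix.mul_smul, cXX, smul_smul, smul_smul, mul_assoc]
  · rw [hYe, Matrix.smul_mul, Matrix.mul_smul, cYY, smul_smul, smul_smul, mul_assoc]

theorem isGaussSummand_smul_star4_mul_kn (t : ℝ) {K : Matrix (Fin 4) (Fin 4) ℝ} (hK : K.IsSymm) :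
    IsGaussSummand (t • (star4 * kn K)) := by
  have hc : ∀ a c, ∑ b, (t • (star4 * kn K)) (a, b) (c, b) = 0 := fun a c => by
    simp only [Matrix.smul_apply, ← Finset.smul_sum, star4_mul_contract K hK, smul_zero]
  obtain ⟨c, h⟩ := star4_mul_kn_sq K hK
  refine ⟨(isFormEndo_star4.mul (isFormEndo_kn K)).smul t, ?_, ⟨t * t * c, ?_⟩, hc⟩
  -- The trace is the trace of the contraction, which already vanishes.
  · rw [Matrix.trace, Fintype.sum_prod_type]
    exact Finset.sum_eq_zero fun a _ => hc a a
  · rw [Matrix.smul_mul, Matrix.mul_smul, h, smul_smul, smul_smul, mul_assoc]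

/-- P is linear in R, so each term of the Gauss equation yields a Gauss summand. Arbitrary real
coefficients are allowed because diagonalising the normal form later produces unnormalised ones,
possibly zero. -/
theorem IsBurnsLike.not_solvesGauss {R : Fin 4 → Fin 4 → Fin 4 → Fin 4 → ℝ}
    (h : IsBurnsLike R) (ε₁ ε₂ : ℝ) :
    ¬ ∃ K L : Matrix (Fin 4) (Fin 4) ℝ, SolvesGauss R ε₁ ε₂ K L := by
  rintro ⟨K, L, hK, hL, hR⟩
  refine h.not_gaussSummands ⟨_, _, isGaussSummand_smul_star4_mul_kn (-(1 / 2) * ε₁) hK,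
    isGaussSummand_smul_star4_mul_kn (-(1 / 2) * ε₂) hL, ?_⟩
  have hp : pairing R = ε₁ • kn K + ε₂ • kn L := by
    ext I J
    exact hR _ _ _ _
  rw [pTensor_eq, hp, Matrix.mul_add, smul_add, Matrix.mul_smul, Matrix.mul_smul, smul_smul,
    smul_smul]

theorem IsBurnsLike.scalar_eq_zero {R : Fin 4 → Fin 4 → Fin 4 → Fin 4 → ℝ} (h : IsBurnsLike R) :
    ∑ i, ∑ j, R i j i j = 0 := by
  obtain ⟨t, O, -, hO, hR⟩ := h
  have h1 : ∑ i, ∑ j, R i j i j = (pairing R).trace := by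
    rw [Matrix.trace, Fintype.sum_prod_type]
    rfl
  have h2 : burnsCurv.trace = 0 := by
    rw [trace_eq_trace_compress isFormEndo_burnsCurv, Matrix.trace, Fin.sum_univ_six]
    simp [compress, burnsCurv, kn, burnsS, burnsA, burnsB, basisPair]
    norm_num
  rw [h1, hR, trace_smul, trace_mul_comm, ← Matrix.mul_assoc,
    mul_eq_one_comm.mp (kronecker_orthogonal hO), Matrix.one_mul, h2, smul_zero]

end RiemGeom

/-! ### First and second derivatives of the Burns metric in a chart -/

namespace TautBundle

open RiemGeom

/-- The conformal factor of the round metric is `(den x) ^ (-2)`. -/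
def den (x : ℂ × ℂ) : ℝ := 1 + ‖x.2‖ ^ 2

theorem den_pos (x : ℂ × ℂ) : 0 < den x := by
  unfold den
  positivity

theorem hasFDerivAt_den (x : ℂ × ℂ) : HasFDerivAt den
    ((2 : ℝ) • (innerSL ℝ x.2).comp (ContinuousLinearMap.snd ℝ ℂ ℂ)) x := by
  have h := (hasFDerivAt_snd (𝕜 := ℝ) (p := x)).norm_sq.const_add 1
  refine h.congr_fderiv ?_
  ext u
  · simp
  · simp
    ring

theorem hasFDerivAt_den_inv_pow (n : ℕ) (x : ℂ × ℂ) : HasFDerivAt (fun z => (den z ^ n)⁻¹)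
    ((-(2 * n) * (den x ^ (n + 1))⁻¹ : ℝ) •
      (innerSL ℝ x.2).comp (ContinuousLinearMap.snd ℝ ℂ ℂ)) x := by
  have hd := (den_pos x).ne'
  have h := (hasDerivAt_inv (pow_ne_zero n hd)).comp_hasFDerivAt x ((hasFDerivAt_den x).pow n)
  refine h.congr_fderiv ?_
  rw [smul_smul, smul_smul]
  congr 1
  rcases n with _ | n
  · simp
  · simp only [Nat.add_sub_cancel]
    rw [nsmul_eq_mul]
    push_cast
    field_simp
    ring

/-- `prodDeriv` is symmetric in its two arguments. Putting the base point in the linear slot makes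
the middle term a product of fixed linear maps, easy to differentiate. -/
theorem burnsForm_apply_prodDeriv (x u v : ℂ × ℂ) : burnsForm x u v =
    inner ℝ u.1 v.1 + inner ℝ (prodDeriv u x) (prodDeriv v x)
      + (den x ^ 2)⁻¹ * inner ℝ u.2 v.2 := by
  rw [burnsForm_apply, den]
  simp only [prodDeriv, add_apply, smul_apply,
    ContinuousLinearMap.coe_fst', ContinuousLinearMap.coe_snd', smul_eq_mul]
  rw [mul_comm x.2 u.1, mul_comm x.2 v.1, mul_comm x.1 u.2, mul_comm x.1 v.2, add_comm (u.1 * _),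
    add_comm (v.1 * _)]

set_option synthInstance.maxHeartbeats 200000 in
theorem hasFDerivAt_burnsForm_apply (x u v : ℂ × ℂ) : HasFDerivAt (fun z => burnsForm z u v)
    ((fderivInnerCLM ℝ (prodDeriv u x, prodDeriv v x)).comp ((prodDeriv u).prod (prodDeriv v))
      + (inner ℝ u.2 v.2 * (-4 * (den x ^ 3)⁻¹) : ℝ) •
        (innerSL ℝ x.2).comp (ContinuousLinearMap.snd ℝ ℂ ℂ)) x := by
  simp only [burnsForm_apply_prodDeriv]
  refine ((((prodDeriv u).hasFDerivAt.inner ℝ (prodDeriv v).hasFDerivAt).const_add _).add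
    ((hasFDerivAt_den_inv_pow 2 x).mul_const _)).congr_fderiv ?_
  rw [smul_smul]
  congr 3
  norm_num

set_option synthInstance.maxHeartbeats 200000 in
theorem fderiv_burnsForm (x u v w : ℂ × ℂ) : fderiv ℝ burnsForm x u v w =
    inner ℝ (prodDeriv v x) (prodDeriv w u) + inner ℝ (prodDeriv v u) (prodDeriv w x)
      - 4 * (den x ^ 3)⁻¹ * inner ℝ x.2 u.2 * inner ℝ v.2 w.2 := by
  have h0 : HasFDerivAt burnsForm (fderiv ℝ burnsForm x) x :=
    (contDiff_burnsForm.differentiable (by simp)).differentiableAt.hasFDerivAt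
  have h1 := (h0.clm_apply (hasFDerivAt_const v x)).clm_apply (hasFDerivAt_const w x)
  have h2 := congrArg (fun L => L u) (h1.unique (hasFDerivAt_burnsForm_apply x v w))
  simp only [add_apply, ContinuousLinearMap.comp_apply,
    ContinuousLinearMap.prod_apply, smul_apply, ContinuousLinearMap.flip_apply,
    zero_apply, fderivInnerCLM_apply, innerSL_apply_apply, smul_eq_mul,
    ContinuousLinearMap.coe_snd', map_zero, zero_add] at h2
  rw [h2]
  ring

theorem secondDeriv_burnsForm (x u v a b : ℂ × ℂ) : secondDeriv burnsForm x u v a b =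
    inner ℝ (prodDeriv a v) (prodDeriv b u) + inner ℝ (prodDeriv a u) (prodDeriv b v)
      - 4 * (den x ^ 3)⁻¹ * inner ℝ u.2 v.2 * inner ℝ a.2 b.2
      + 24 * (den x ^ 4)⁻¹ * inner ℝ x.2 u.2 * inner ℝ x.2 v.2 * inner ℝ a.2 b.2 := by
  have h0 : (fun z => fderiv ℝ (fun t => burnsForm t a b) z v) = fun z =>
      inner ℝ (prodDeriv a z) (prodDeriv b v) + inner ℝ (prodDeriv a v) (prodDeriv b z)
      + inner ℝ a.2 b.2 * (-4) * ((den z ^ 3)⁻¹ * inner ℝ z.2 v.2) := by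
    funext z
    rw [(hasFDerivAt_burnsForm_apply z a b).fderiv]
    simp only [add_apply, ContinuousLinearMap.comp_apply,
      ContinuousLinearMap.prod_apply, smul_apply, fderivInnerCLM_apply,
      innerSL_apply_apply, smul_eq_mul, ContinuousLinearMap.coe_snd']
    ring
  have h1 := (((prodDeriv a).hasFDerivAt (x := x)).inner ℝ
    (hasFDerivAt_const (prodDeriv b v) x)).add
    ((hasFDerivAt_const (prodDeriv a v) x).inner ℝ ((prodDeriv b).hasFDerivAt (x := x)))
  have h2 := ((hasFDerivAt_den_inv_pow 3 x).mul ((hasFDerivAt_snd (𝕜 := ℝ) (p := x)).inner ℝ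
    (hasFDerivAt_const v.2 x))).const_mul (inner ℝ a.2 b.2 * (-4))
  rw [secondDeriv, h0]
  refine (congrArg (fun L => L u) (h1.add h2).fderiv).trans ?_
  simp only [add_apply, ContinuousLinearMap.comp_apply,
    ContinuousLinearMap.prod_apply, smul_apply, fderivInnerCLM_apply,
    innerSL_apply_apply, smul_eq_mul, ContinuousLinearMap.coe_snd', zero_apply,
    inner_zero_left, inner_zero_right]
  push_cast
  ring

end TautBundle

/-! ### Christoffel symbols and curvature of the Burns metric in a chart -/

namespace RiemGeom

/-- Positivity makes `G y` injective, hence an isomorphism onto the dual in finite dimension, so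
`inverse` is a true inverse and not its default value. -/
theorem apply_christoffel {E : Type} [NormedAddCommGroup E] [NormedSpace ℝ E]
    [FiniteDimensional ℝ E] (G : E → E →L[ℝ] E →L[ℝ] ℝ) (y : E)
    (hG : ∀ u, u ≠ 0 → 0 < G y u u) (u v : E) :
    G y (christoffel G y u v) = christoffelForm G y u v := by
  have hinj : Function.Injective (G y : E →ₗ[ℝ] E →L[ℝ] ℝ) := by
    refine (injective_iff_map_eq_zero _).mpr fun u hu => ?_
    by_contra h
    have h1 := hG u h
    have h2 : G y u = 0 := hu
    rw [h2] at h1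
    exact lt_irrefl _ h1
  have hrank : Module.finrank ℝ E = Module.finrank ℝ (E →L[ℝ] ℝ) := by
    rw [← LinearEquiv.finrank_eq (LinearMap.toContinuousLinearMap (𝕜 := ℝ) (E := E) (F' := ℝ))]
    exact (Subspace.dual_finrank_eq (K := ℝ) (V := E)).symm
  have hsurj := (LinearMap.injective_iff_surjective_of_finrank_eq_finrank hrank).mp hinj
  let e : E ≃L[ℝ] (E →L[ℝ] ℝ) := (LinearEquiv.ofBijective _ ⟨hinj, hsurj⟩).toContinuousLinearEquiv
  have he : G y = e := by
    ext u
    rfl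
  rw [christoffel, he, ContinuousLinearMap.inverse_equiv]
  exact e.apply_symm_apply _

end RiemGeom

namespace TautBundle

open RiemGeom ComplexConjugate

/-- The flat part contributes the second derivative of the blow-down map. For the sphere, the three
real inner products in the conformal Christoffel symbols combine into one complex product. -/
theorem christoffelForm_burnsForm (x u v w : ℂ × ℂ) : christoffelForm burnsForm x u v w =
    inner ℝ (prodDeriv u v) (prodDeriv w x)
      - 2 * (den x ^ 3)⁻¹ * inner ℝ (conj x.2 * (u.2 * v.2)) w.2 := by
  have hc : ∀ a b, prodDeriv a b = prodDeriv b a := fun a b => by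
    simp [prodDeriv]
    ring
  simp only [christoffelForm, smul_apply, sub_apply, add_apply,
    ContinuousLinearMap.flip_apply, fderiv_burnsForm, smul_eq_mul]
  rw [hc v u, hc w u, hc w v]
  simp only [Complex.inner, Complex.mul_re, Complex.mul_im, Complex.conj_re, Complex.conj_im]
  ring

/-- `1 + |z|²`, where `z` is the image of a point under the blow-down map. -/
def onePlusRhoSq (x : ℂ × ℂ) : ℝ := 1 + ‖x.1‖ ^ 2 * den x

theorem onePlusRhoSq_pos (x : ℂ × ℂ) : 0 < onePlusRhoSq x := by
  have := den_pos x
  unfold onePlusRhoSq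
  positivity

/-- The second component of the solution of the linear system that determines the Christoffel
symbols of the Burns metric. -/
def gammaSnd (x : ℂ × ℂ) (q s : ℂ) : ℂ :=
  (onePlusRhoSq x)⁻¹ • (den x • (conj x.1 * q) - (2 * (den x)⁻¹) • (conj x.2 * s))

/-- The solution of the linear system that determines the Christoffel symbols of the Burns
metric. -/
def gamma (x : ℂ × ℂ) (q s : ℂ) : ℂ × ℂ :=
  ((den x)⁻¹ • (conj x.2 * (q - x.1 * gammaSnd x q s)), gammaSnd x q s)

/-- Testing against the fibre direction gives `den x` times the first component in terms of the
second. Eliminating it leaves `onePlusRhoSq x` as the coefficient of the second. -/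
theorem burnsForm_gamma (x w : ℂ × ℂ) (q s : ℂ) : burnsForm x (gamma x q s) w =
    inner ℝ q (prodDeriv w x) - 2 * (den x ^ 3)⁻¹ * inner ℝ (conj x.2 * s) w.2 := by
  have hD := (den_pos x).ne'
  have hN := (onePlusRhoSq_pos x).ne'
  obtain ⟨⟨lr, li⟩, wr, wi⟩ := x
  obtain ⟨⟨ar, ai⟩, br, bi⟩ := w
  obtain ⟨qr, qi⟩ := q
  obtain ⟨sr, si⟩ := s
  rw [burnsForm_apply_prodDeriv]
  simp only [gamma, gammaSnd]
  set D := den (⟨lr, li⟩, ⟨wr, wi⟩) with hDd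
  set N := onePlusRhoSq (⟨lr, li⟩, ⟨wr, wi⟩) with hNd
  have hN' : N = 1 + (lr * lr + li * li) * D := by
    rw [hNd, onePlusRhoSq, Complex.sq_norm, Complex.normSq_apply]
  have hD' : D = 1 + (wr * wr + wi * wi) := by
    rw [hDd, den, Complex.sq_norm, Complex.normSq_apply]
  clear_value D N
  simp [Complex.inner, prodDeriv]
  field_simp
  rw [hN', hD']
  ring

theorem christoffel_burnsForm (x u v : ℂ × ℂ) :
    christoffel burnsForm x u v = gamma x (prodDeriv u v) (u.2 * v.2) := by
  have h : burnsForm x (christoffel burnsForm x u v - gamma x (prodDeriv u v) (u.2 * v.2)) = 0 := by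
    rw [map_sub, apply_christoffel _ _ (burnsForm_pos x), sub_eq_zero]
    refine ContinuousLinearMap.ext fun w => ?_
    rw [christoffelForm_burnsForm, burnsForm_gamma]
  by_contra hne
  have := burnsForm_pos x _ (sub_ne_zero.mpr hne)
  rw [h] at this
  exact lt_irrefl _ this

/-- The normal component of the second derivative of the blow-down map. -/
def qHat (x : ℂ × ℂ) (q s : ℂ) : ℂ := q + (2 * (den x)⁻¹) • (x.1 * conj x.2 * s)

/-- The first two terms are arranged to combine with the second derivatives of the metric in the
curvature. The last one survives and carries all the extrinsic curvature of the blow-down part. -/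
theorem burnsForm_gamma_gamma (x : ℂ × ℂ) (q s q' s' : ℂ) :
    burnsForm x (gamma x q s) (gamma x q' s') = inner ℝ q q'
      + 4 * (den x ^ 4)⁻¹ * ‖x.2‖ ^ 2 * inner ℝ s s'
      - (den x * onePlusRhoSq x)⁻¹ * inner ℝ (qHat x q s) (qHat x q' s') := by
  have hD := (den_pos x).ne'
  have hN := (onePlusRhoSq_pos x).ne'
  rw [burnsForm_gamma]
  obtain ⟨⟨lr, li⟩, wr, wi⟩ := x
  obtain ⟨qr, qi⟩ := q
  obtain ⟨sr, si⟩ := s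
  obtain ⟨qr', qi'⟩ := q'
  obtain ⟨sr', si'⟩ := s'
  simp only [gamma, gammaSnd, qHat]
  set D := den (⟨lr, li⟩, ⟨wr, wi⟩) with hDd
  set N := onePlusRhoSq (⟨lr, li⟩, ⟨wr, wi⟩) with hNd
  have hN' : N = 1 + (lr * lr + li * li) * D := by
    rw [hNd, onePlusRhoSq, Complex.sq_norm, Complex.normSq_apply]
  have hD' : D = 1 + (wr * wr + wi * wi) := by
    rw [hDd, den, Complex.sq_norm, Complex.normSq_apply]
  clear_value D N
  rw [Complex.sq_norm, Complex.normSq_apply]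
  simp [Complex.inner, prodDeriv]
  field_simp
  rw [hN', hD']
  ring

theorem riemannCoord_burnsForm (x a b c d : ℂ × ℂ) : riemannCoord burnsForm x a b c d =
    (den x * onePlusRhoSq x)⁻¹ *
      (inner ℝ (qHat x (prodDeriv a c) (a.2 * c.2)) (qHat x (prodDeriv b d) (b.2 * d.2))
        - inner ℝ (qHat x (prodDeriv a d) (a.2 * d.2)) (qHat x (prodDeriv b c) (b.2 * c.2)))
    + 4 * (den x ^ 4)⁻¹ *
      (inner ℝ a.2 c.2 * inner ℝ b.2 d.2 - inner ℝ a.2 d.2 * inner ℝ b.2 c.2) := by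
  have hc : ∀ a b, prodDeriv a b = prodDeriv b a := fun a b => by
    simp [prodDeriv]
    ring
  have hD := (den_pos x).ne'
  simp only [riemannCoord, secondDeriv_burnsForm, christoffel_burnsForm, burnsForm_gamma_gamma]
  rw [hc b a, hc c a, hc d a, hc c b, hc d b, hc d c,
    real_inner_comm (prodDeriv b c) (prodDeriv a d),
    real_inner_comm (prodDeriv b d) (prodDeriv a c),
    real_inner_comm (qHat x (prodDeriv b c) _), real_inner_comm (qHat x (prodDeriv b d) _),
    real_inner_comm (prodDeriv c d) (prodDeriv a b)]
  -- This is the curvature of the round sphere of radius 1/2, of Gauss curvature 4. Everything from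
  -- the flat part other than the `qHat` terms cancels.
  have key : -(4 * (den x ^ 4)⁻¹ * ‖x.2‖ ^ 2 * (inner ℝ (a.2 * c.2) (b.2 * d.2)
      - inner ℝ (a.2 * d.2) (b.2 * c.2)))
      + ((-4 * (den x ^ 3)⁻¹ * inner ℝ b.2 c.2
          + 24 * (den x ^ 4)⁻¹ * inner ℝ x.2 b.2 * inner ℝ x.2 c.2) * inner ℝ a.2 d.2
        + (-4 * (den x ^ 3)⁻¹ * inner ℝ a.2 d.2
          + 24 * (den x ^ 4)⁻¹ * inner ℝ x.2 a.2 * inner ℝ x.2 d.2) * inner ℝ b.2 c.2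
        - (-4 * (den x ^ 3)⁻¹ * inner ℝ b.2 d.2
          + 24 * (den x ^ 4)⁻¹ * inner ℝ x.2 b.2 * inner ℝ x.2 d.2) * inner ℝ a.2 c.2
        - (-4 * (den x ^ 3)⁻¹ * inner ℝ a.2 c.2
          + 24 * (den x ^ 4)⁻¹ * inner ℝ x.2 a.2 * inner ℝ x.2 c.2) * inner ℝ b.2 d.2) / 2
      = 4 * (den x ^ 4)⁻¹ *
      (inner ℝ a.2 c.2 * inner ℝ b.2 d.2 - inner ℝ a.2 d.2 * inner ℝ b.2 c.2) := by
    have hD' : den x = 1 + (x.2.re * x.2.re + x.2.im * x.2.im) := by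
      rw [den, Complex.sq_norm, Complex.normSq_apply]
    have h3 : (den x ^ 3)⁻¹ = den x * (den x ^ 4)⁻¹ := by field_simp
    rw [h3]
    generalize (den x ^ 4)⁻¹ = t
    rw [hD', Complex.sq_norm, Complex.normSq_apply]
    simp only [Complex.inner, Complex.mul_re, Complex.mul_im, Complex.conj_re, Complex.conj_im]
    ring
  rw [← key]
  rw [real_inner_comm (a.2 * c.2), real_inner_comm (a.2 * d.2)]
  ring

end TautBundle

/-! ### Kähler property, unitary coframe and curvature in a frame -/

namespace TautBundle

open RiemGeom ComplexConjugate
open scoped Kronecker Matrix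

/-- The derivative of the inverse chart is the tangent coordinate change, under which `burnsForm` is
invariant. The chart target is all of ℂ × ℂ, so the functions agree everywhere. -/
theorem metricInChart_burnsMetric (p : TautBundle) : metricInChart burnsMetric p = burnsForm := by
  funext y
  refine ContinuousLinearMap.ext fun u => ContinuousLinearMap.ext fun v => ?_
  set q := (chartAt (ℂ × ℂ) p).symm y with hq
  have hqs : q ∈ (chartAt (ℂ × ℂ) p).source := (chartAt (ℂ × ℂ) p).map_target (Set.mem_univ y)
  have hy : chartAt (ℂ × ℂ) p q = y := (chartAt (ℂ × ℂ) p).right_inv (Set.mem_univ y)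
  have h := burnsForm_coordChange p q hqs u v
  rw [hy, tangentBundleCore_coordChange_achart] at h
  have hm : MDifferentiableAt 𝓘(ℝ, ℂ × ℂ) 𝓘(ℝ, ℂ × ℂ) (chartAt (ℂ × ℂ) p).symm y :=
    mdifferentiableAt_atlas_symm (chart_mem_atlas _ p) (Set.mem_univ y)
  have hd : mfderiv 𝓘(ℝ, ℂ × ℂ) 𝓘(ℝ, ℂ × ℂ) (chartAt (ℂ × ℂ) p).symm y =
      fderivWithin ℝ (extChartAt 𝓘(ℝ, ℂ × ℂ) q ∘ (extChartAt 𝓘(ℝ, ℂ × ℂ) p).symm)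
        (Set.range 𝓘(ℝ, ℂ × ℂ)) (extChartAt 𝓘(ℝ, ℂ × ℂ) p q) := by
    have hy' : extChartAt 𝓘(ℝ, ℂ × ℂ) p q = y := hy
    rw [hy']
    exact hm.mfderiv
  rw [← h, ← hd]
  rfl

-- Conceptually, the Kähler form is a sum of pull-backs of Kähler forms of ℂ² and ℂP¹ by holomorphic
-- maps. In coordinates the cyclic sum of `fderiv_burnsForm` cancels.
set_option synthInstance.maxHeartbeats 200000 in
theorem isKahler_burnsMetric : IsKahler burnsMetric := by
  intro p
  rw [metricInChart_burnsMetric]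
  generalize chartAt (ℂ × ℂ) p p = x
  refine ⟨fun u v => ?_, fun u v w => ?_⟩
  · rw [burnsForm_apply, burnsForm_apply]
    simp [Complex.inner]
    ring
  · rw [fderiv_burnsForm, fderiv_burnsForm, fderiv_burnsForm]
    simp [Complex.inner, prodDeriv]
    ring

/-- The first component of a unitary coframe of the Burns metric. -/
def xiForm (x u : ℂ × ℂ) : ℂ := √(den x) • (u.1 + (den x)⁻¹ • (x.1 * conj x.2 * u.2))

/-- The second component of a unitary coframe of the Burns metric. -/
def etaForm (x u : ℂ × ℂ) : ℂ := (√(onePlusRhoSq x) * (den x)⁻¹) • u.2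

theorem real_inner_smul_smul (s : ℝ) (a b : ℂ) :
    inner ℝ (s • a) (s • b) = s ^ 2 * inner ℝ a b := by
  rw [real_inner_smul_left, real_inner_smul_right]
  ring

theorem inner_etaForm (x u v : ℂ × ℂ) : inner ℝ (etaForm x u) (etaForm x v) =
    onePlusRhoSq x * (den x ^ 2)⁻¹ * inner ℝ u.2 v.2 := by
  rw [etaForm, etaForm, real_inner_smul_smul, mul_pow, Real.sq_sqrt (onePlusRhoSq_pos x).le,
    inv_pow]

/-- Complete the square in the fibre differential; what remains of |dw|² has coefficient (1 + ρ²)/(1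
+ |w|²)². -/
theorem burnsForm_eq_xiForm_add_etaForm (x u v : ℂ × ℂ) : burnsForm x u v =
    inner ℝ (xiForm x u) (xiForm x v) + inner ℝ (etaForm x u) (etaForm x v) := by
  have hD := (den_pos x).ne'
  rw [burnsForm_apply, inner_etaForm, xiForm, xiForm, real_inner_smul_smul,
    Real.sq_sqrt (den_pos x).le, onePlusRhoSq]
  have h : (1 + ‖x.2‖ ^ 2) = den x := rfl
  have hD' : den x = 1 + (x.2.re * x.2.re + x.2.im * x.2.im) := by
    rw [den, Complex.sq_norm, Complex.normSq_apply]
  rw [h, Complex.sq_norm, Complex.normSq_apply]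
  generalize den x = D at *
  simp [Complex.inner]
  field_simp
  rw [hD']
  ring

theorem xiForm_mul_etaForm (x u v : ℂ × ℂ) :
    xiForm x u * etaForm x v + etaForm x u * xiForm x v =
      (√(den x) * (√(onePlusRhoSq x) * (den x)⁻¹)) • qHat x (prodDeriv u v) (u.2 * v.2) := by
  simp only [xiForm, etaForm, qHat, prodDeriv, Complex.real_smul, add_apply, smul_apply,
    ContinuousLinearMap.coe_fst', ContinuousLinearMap.coe_snd', smul_eq_mul]
  push_cast
  ring

/-- Since `qHat` is a multiple of the symmetrised product ξη, the point enters only through a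
positive scalar: the curvature has the same algebraic type everywhere, including the zero section.
-/
theorem riemannCoord_burnsForm_eq (x a b c d : ℂ × ℂ) : riemannCoord burnsForm x a b c d =
    (onePlusRhoSq x ^ 2)⁻¹ *
      (4 * (inner ℝ (etaForm x a) (etaForm x c) * inner ℝ (etaForm x b) (etaForm x d)
          - inner ℝ (etaForm x a) (etaForm x d) * inner ℝ (etaForm x b) (etaForm x c))
        + (inner ℝ (xiForm x a * etaForm x c + etaForm x a * xiForm x c)
            (xiForm x b * etaForm x d + etaForm x b * xiForm x d)
          - inner ℝ (xiForm x a * etaForm x d + etaForm x a * xiForm x d)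
            (xiForm x b * etaForm x c + etaForm x b * xiForm x c))) := by
  have hD := (den_pos x).ne'
  have hN := (onePlusRhoSq_pos x).ne'
  rw [riemannCoord_burnsForm]
  simp only [inner_etaForm, xiForm_mul_etaForm, real_inner_smul_smul, mul_pow,
    Real.sq_sqrt (den_pos x).le, Real.sq_sqrt (onePlusRhoSq_pos x).le]
  field_simp
  ring

/-- The components of a frame in the unitary coframe. -/
def frameMatrix (x : ℂ × ℂ) (e : Fin 4 → ℂ × ℂ) : Matrix (Fin 4) (Fin 4) ℝ :=
  Matrix.of fun i => ![(xiForm x (e i)).re, (xiForm x (e i)).im, (etaForm x (e i)).re,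
    (etaForm x (e i)).im]

/-- The matrices `burnsS`, `burnsA`, `burnsB` represent |η|² and the real and imaginary parts of the
symmetrised ξη. The components of the frame in the coframe form the orthogonal matrix. -/
theorem isBurnsLike_riemannFrame (p : TautBundle) (e : Fin 4 → TangentSpace 𝓘(ℝ, ℂ × ℂ) p)
    (he : IsFrame burnsMetric p e) : IsBurnsLike (riemannFrame burnsMetric p e) := by
  set x := chartAt (ℂ × ℂ) p p with hx
  set O := frameMatrix x e with hO
  have hR : ∀ i j k l, riemannFrame burnsMetric p e i j k l =
      riemannCoord burnsForm x (e i) (e j) (e k) (e l) := fun i j k l => by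
    rw [riemannFrame, riemann, metricInChart_burnsMetric]
  refine ⟨(onePlusRhoSq x ^ 2)⁻¹, O, inv_ne_zero (pow_ne_zero 2 (onePlusRhoSq_pos x).ne'), ?_, ?_⟩
  · ext i j
    have h := he i j
    rw [Matrix.one_apply, ← h]
    refine Eq.trans ?_ (burnsForm_eq_xiForm_add_etaForm x (e i) (e j)).symm
    simp [Matrix.mul_apply, Fin.sum_univ_four, hO, frameMatrix, Complex.inner]
    ring
  · have hc : (O ⊗ₖ O) * burnsCurv * (O ⊗ₖ O)ᵀ =
        (4 : ℝ) • kn (O * burnsS * Oᵀ) + kn (O * burnsA * Oᵀ) + kn (O * burnsB * Oᵀ) := by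
      rw [kn_conj, kn_conj, kn_conj, burnsCurv, Matrix.mul_add, Matrix.mul_add, Matrix.add_mul,
        Matrix.add_mul, Matrix.mul_smul, Matrix.smul_mul]
    have hS : ∀ i k, (O * burnsS * Oᵀ) i k = inner ℝ (etaForm x (e i)) (etaForm x (e k)) :=
      fun i k => by
        simp [Matrix.mul_apply, Fin.sum_univ_four, hO, frameMatrix, Complex.inner, burnsS]
        ring
    have hA : ∀ i k, (O * burnsA * Oᵀ) i k =
        (xiForm x (e i) * etaForm x (e k) + etaForm x (e i) * xiForm x (e k)).re := fun i k => by
      simp [Matrix.mul_apply, Fin.sum_univ_four, hO, frameMatrix, burnsA]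
      ring
    have hB : ∀ i k, (O * burnsB * Oᵀ) i k =
        (xiForm x (e i) * etaForm x (e k) + etaForm x (e i) * xiForm x (e k)).im := fun i k => by
      simp [Matrix.mul_apply, Fin.sum_univ_four, hO, frameMatrix, burnsB]
      ring
    rw [hc]
    ext ⟨i, j⟩ ⟨k, l⟩
    refine (hR i j k l).trans ((riemannCoord_burnsForm_eq x _ _ _ _).trans ?_)
    simp only [Matrix.smul_apply, Matrix.add_apply, kn, Matrix.of_apply, hS, hA, hB, smul_eq_mul]
    congr 1
    rw [add_assoc]
    congr 1
    simp only [Complex.inner, Complex.mul_re, Complex.conj_re, Complex.conj_im]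
    ring

end TautBundle

/-! ### The Gauss equation for maps into a pseudo-Euclidean space -/

namespace RiemGeom

section Gauss

variable {E F : Type} [NormedAddCommGroup E] [NormedSpace ℝ E]
  [NormedAddCommGroup F] [NormedSpace ℝ F]

/-- The normal part of the second derivative of a map that induces the metric `G`. -/
def secondFundamental (f : E → F) (G : E → E →L[ℝ] E →L[ℝ] ℝ) (y u v : E) : F :=
  fderiv ℝ (fderiv ℝ f) y u v - fderiv ℝ f y (christoffel G y u v)

variable {f : E → F} {G : E → E →L[ℝ] E →L[ℝ] ℝ} {B : F →L[ℝ] F →L[ℝ] ℝ}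

theorem hasFDerivAt_clm_apply_apply {H X Y : Type} [NormedAddCommGroup H] [NormedSpace ℝ H]
    [NormedAddCommGroup X] [NormedSpace ℝ X] [NormedAddCommGroup Y] [NormedSpace ℝ Y]
    {L : H → X →L[ℝ] Y} {y : H} (hL : DifferentiableAt ℝ L y) (v : X) :
    HasFDerivAt (fun z => L z v) ((fderiv ℝ L y).flip v) y := by
  refine (hL.hasFDerivAt.clm_apply (hasFDerivAt_const v y)).congr_fderiv ?_
  ext u
  simp

theorem hasFDerivAt_bilin {H : Type} [NormedAddCommGroup H] [NormedSpace ℝ H]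
    (B : F →L[ℝ] F →L[ℝ] ℝ) {a b : H → F} {a' b' : H →L[ℝ] F} {y : H}
    (ha : HasFDerivAt a a' y) (hb : HasFDerivAt b b' y) :
    HasFDerivAt (fun z => B (a z) (b z)) ((B.flip (b y)).comp a' + (B (a y)).comp b') y := by
  refine ((B.hasFDerivAt.comp y ha).clm_apply hb).congr_fderiv ?_
  ext u
  simp [add_comm]

theorem contDiff_fderiv_infty (hf : ContDiff ℝ ∞ f) : ContDiff ℝ ∞ (fderiv ℝ f) :=
  hf.fderiv_right (by simp)

theorem fderiv_fderiv_comm (hf : ContDiff ℝ ∞ f) (y u v : E) :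
    fderiv ℝ (fderiv ℝ f) y u v = fderiv ℝ (fderiv ℝ f) y v u :=
  by
  refine (hf.contDiffAt.isSymmSndFDerivAt ?_).eq u v
  rw [minSmoothness_of_isRCLikeNormedField]
  exact WithTop.coe_le_coe.mpr le_top

theorem fderiv_induced (hf : ContDiff ℝ ∞ f)
    (hG : ∀ z u v, G z u v = B (fderiv ℝ f z u) (fderiv ℝ f z v)) (y u v w : E) :
    fderiv ℝ (fun z => G z v w) y u =
      B (fderiv ℝ (fderiv ℝ f) y u v) (fderiv ℝ f y w)
        + B (fderiv ℝ f y v) (fderiv ℝ (fderiv ℝ f) y u w) := by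
  have h1 : DifferentiableAt ℝ (fderiv ℝ f) y :=
    ((contDiff_fderiv_infty hf).differentiable (by simp)).differentiableAt
  simp only [hG]
  rw [(hasFDerivAt_bilin B (hasFDerivAt_clm_apply_apply h1 v)
    (hasFDerivAt_clm_apply_apply h1 w)).fderiv]
  rfl

theorem secondDeriv_induced (hf : ContDiff ℝ ∞ f)
    (hG : ∀ z u v, G z u v = B (fderiv ℝ f z u) (fderiv ℝ f z v)) (y u v a b : E) :
    secondDeriv G y u v a b =
      B (fderiv ℝ (fderiv ℝ (fderiv ℝ f)) y u v a) (fderiv ℝ f y b)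
      + B (fderiv ℝ (fderiv ℝ f) y v a) (fderiv ℝ (fderiv ℝ f) y u b)
      + (B (fderiv ℝ (fderiv ℝ f) y u a) (fderiv ℝ (fderiv ℝ f) y v b)
      + B (fderiv ℝ f y a) (fderiv ℝ (fderiv ℝ (fderiv ℝ f)) y u v b)) := by
  have h1 : DifferentiableAt ℝ (fderiv ℝ f) y :=
    ((contDiff_fderiv_infty hf).differentiable (by simp)).differentiableAt
  have h2 : DifferentiableAt ℝ (fderiv ℝ (fderiv ℝ f)) y :=
    ((contDiff_fderiv_infty (contDiff_fderiv_infty hf)).differentiable (by simp)).differentiableAt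
  have e : ∀ a, HasFDerivAt (fun z => fderiv ℝ (fderiv ℝ f) z v a)
      (((fderiv ℝ (fderiv ℝ (fderiv ℝ f)) y).flip v).flip a) y := fun a => by
    have h3 := hasFDerivAt_clm_apply_apply h2 v
    have h4 := hasFDerivAt_clm_apply_apply h3.differentiableAt a
    rwa [h3.fderiv] at h4
  rw [secondDeriv]
  simp only [fderiv_induced hf hG]
  exact congrArg (fun L => L u) ((hasFDerivAt_bilin B (e a) (hasFDerivAt_clm_apply_apply h1 b)).add
    (hasFDerivAt_bilin B (hasFDerivAt_clm_apply_apply h1 a) (e b))).fderiv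

variable [FiniteDimensional ℝ E]

theorem differentiable_induced (hf : ContDiff ℝ ∞ f)
    (hG : ∀ z u v, G z u v = B (fderiv ℝ f z u) (fderiv ℝ f z v)) : Differentiable ℝ G := by
  have h : ContDiff ℝ ∞ G := by
    refine contDiff_clm_apply_iff.mpr fun u => contDiff_clm_apply_iff.mpr fun v => ?_
    simp only [hG]
    have hd : ∀ u, ContDiff ℝ ∞ fun z => fderiv ℝ f z u := fun u =>
      (contDiff_fderiv_infty hf).clm_apply contDiff_const
    exact (B.contDiff.comp (hd u)).clm_apply (hd v)
  exact h.differentiable (by simp)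

/-- The Koszul formula: the image of the Christoffel vector is the tangential part of the second
derivative of `f`. -/
theorem apply_fderiv_christoffel (hf : ContDiff ℝ ∞ f)
    (hG : ∀ z u v, G z u v = B (fderiv ℝ f z u) (fderiv ℝ f z v)) (hB : ∀ a b, B a b = B b a)
    {y : E} (hpos : ∀ u, u ≠ 0 → 0 < G y u u) (u v w : E) :
    B (fderiv ℝ f y (christoffel G y u v)) (fderiv ℝ f y w) =
      B (fderiv ℝ (fderiv ℝ f) y u v) (fderiv ℝ f y w) := by
  have hfd : ∀ u v w, fderiv ℝ G y u v w =
      B (fderiv ℝ (fderiv ℝ f) y u v) (fderiv ℝ f y w)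
        + B (fderiv ℝ f y v) (fderiv ℝ (fderiv ℝ f) y u w) := fun u v w => by
    have h0 := hasFDerivAt_clm_apply_apply (hasFDerivAt_clm_apply_apply
      (differentiable_induced hf hG y) v).differentiableAt w
    have h1 := (hasFDerivAt_clm_apply_apply (differentiable_induced hf hG y) v).fderiv
    rw [← fderiv_induced hf hG, h0.fderiv, h1]
    rfl
  rw [← hG, apply_christoffel G y hpos]
  simp only [christoffelForm, smul_apply, sub_apply, add_apply,
    ContinuousLinearMap.flip_apply, hfd, smul_eq_mul]
  rw [fderiv_fderiv_comm hf y v u, fderiv_fderiv_comm hf y w u, fderiv_fderiv_comm hf y w v,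
    hB (fderiv ℝ (fderiv ℝ f) y u w)]
  ring

theorem apply_secondFundamental (hf : ContDiff ℝ ∞ f)
    (hG : ∀ z u v, G z u v = B (fderiv ℝ f z u) (fderiv ℝ f z v)) (hB : ∀ a b, B a b = B b a)
    {y : E} (hpos : ∀ u, u ≠ 0 → 0 < G y u u) (u v w : E) :
    B (secondFundamental f G y u v) (fderiv ℝ f y w) = 0 := by
  rw [secondFundamental, map_sub, sub_apply, apply_fderiv_christoffel hf hG hB hpos, sub_self]

theorem secondFundamental_comm (hf : ContDiff ℝ ∞ f)
    (hG : ∀ z u v, G z u v = B (fderiv ℝ f z u) (fderiv ℝ f z v)) (hB : ∀ a b, B a b = B b a)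
    {y : E} (hpos : ∀ u, u ≠ 0 → 0 < G y u u) (u v : E) :
    secondFundamental f G y u v = secondFundamental f G y v u := by
  have h : christoffel G y u v - christoffel G y v u = 0 := by
    by_contra hne
    have h1 := hpos _ hne
    rw [hG] at h1
    nth_rw 1 [map_sub] at h1
    rw [map_sub, sub_apply, apply_fderiv_christoffel hf hG hB hpos,
      apply_fderiv_christoffel hf hG hB hpos, fderiv_fderiv_comm hf y u v, sub_self] at h1
    exact lt_irrefl _ h1
  rw [secondFundamental, secondFundamental, fderiv_fderiv_comm hf y u v, sub_eq_zero.mp h]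

/-- The Gauss equation for a metric induced by a map into a pseudo-Euclidean space. -/
theorem riemannCoord_induced (hf : ContDiff ℝ ∞ f)
    (hG : ∀ z u v, G z u v = B (fderiv ℝ f z u) (fderiv ℝ f z v)) (hB : ∀ a b, B a b = B b a)
    {y : E} (hpos : ∀ u, u ≠ 0 → 0 < G y u u) (a b c d : E) :
    riemannCoord G y a b c d =
      B (secondFundamental f G y a c) (secondFundamental f G y b d)
      - B (secondFundamental f G y a d) (secondFundamental f G y b c) := by
  have hf1 := contDiff_fderiv_infty hf
  have c12 : ∀ u v w, fderiv ℝ (fderiv ℝ (fderiv ℝ f)) y u v w =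
      fderiv ℝ (fderiv ℝ (fderiv ℝ f)) y v u w := fun u v w => by
    rw [fderiv_fderiv_comm hf1]
  have h2 : DifferentiableAt ℝ (fderiv ℝ (fderiv ℝ f)) y :=
    ((contDiff_fderiv_infty hf1).differentiable (by simp)).differentiableAt
  have e : ∀ v a, HasFDerivAt (fun z => fderiv ℝ (fderiv ℝ f) z v a)
      (((fderiv ℝ (fderiv ℝ (fderiv ℝ f)) y).flip v).flip a) y := fun v a => by
    have h3 := hasFDerivAt_clm_apply_apply h2 v
    have h4 := hasFDerivAt_clm_apply_apply h3.differentiableAt a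
    rwa [h3.fderiv] at h4
  -- Differentiating the symmetry of the second derivative gives that of the third in its last two
  -- slots; with `c12` it is fully symmetric.
  have c23 : ∀ u v w, fderiv ℝ (fderiv ℝ (fderiv ℝ f)) y u v w =
      fderiv ℝ (fderiv ℝ (fderiv ℝ f)) y u w v := fun u v w => by
    have h3 := e v w
    simp only [fun z => fderiv_fderiv_comm hf z v w] at h3
    exact congrArg (fun L => L u) (h3.unique (e w v))
  have hn := apply_secondFundamental hf hG hB hpos
  have hN : ∀ u v u' v', B (secondFundamental f G y u v) (secondFundamental f G y u' v') =
      B (fderiv ℝ (fderiv ℝ f) y u v) (fderiv ℝ (fderiv ℝ f) y u' v')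
        - G y (christoffel G y u v) (christoffel G y u' v') := fun u v u' v' => by
    have h3 : B (secondFundamental f G y u v) (secondFundamental f G y u' v') =
        B (secondFundamental f G y u v) (fderiv ℝ (fderiv ℝ f) y u' v') := by
      conv_lhs => rw [secondFundamental.eq_def f G y u' v', map_sub, hn, sub_zero]
    rw [h3, secondFundamental, map_sub, sub_apply, hB (fderiv ℝ f y _),
      ← apply_fderiv_christoffel hf hG hB hpos, hG, hB (fderiv ℝ f y (christoffel G y u' v'))]
  rw [riemannCoord, hN, hN]
  simp only [secondDeriv_induced hf hG]
  -- These rewrites put the third derivatives into a common order, so that they cancel in the skew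
  -- combination and only products of second derivatives remain.
  rw [c23 b c a, c12 b a c, c23 b d a, c12 b a d, c23 a c b, c23 a d b]
  rw [c12 b c d, c12 b d c, c12 a d c, c12 a c d]
  rw [c23 d b c, c12 d c b, c23 c d b]
  rw [c23 d a c, c12 d c a, c23 c d a]
  have k := fderiv_fderiv_comm hf y
  rw [k c a, k c b, k b a, k d a, k d b, k d c]
  have hGs : ∀ u v, G y u v = G y v u := fun u v => by rw [hG, hG, hB]
  simp only [hB (fderiv ℝ f y _)]
  rw [hB (fderiv ℝ (fderiv ℝ f) y b d), hB (fderiv ℝ (fderiv ℝ f) y b c),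
    hGs (christoffel G y b c), hGs (christoffel G y b d)]
  ring

end Gauss

end RiemGeom

/-! ### Codimension at most two: from a normal bundle to a pair of symmetric matrices -/

namespace RiemGeom

/-- A symmetric bilinear form on a space of dimension at most two is a combination of two squares of
linear forms. -/
theorem exists_eq_add_of_finrank_le_two {W : Type} [AddCommGroup W] [Module ℝ W]
    [FiniteDimensional ℝ W] (b : LinearMap.BilinForm ℝ W) (hb : b.IsSymm)
    (hW : Module.finrank ℝ W ≤ 2) : ∃ (ε₁ ε₂ : ℝ) (φ ψ : W →ₗ[ℝ] ℝ),
      ∀ n n', b n n' = ε₁ * (φ n * φ n') + ε₂ * (ψ n * ψ n') := by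
  obtain ⟨v, hv⟩ := LinearMap.BilinForm.exists_orthogonal_basis
    (LinearMap.BilinForm.isSymm_iff.mp hb)
  have h : ∀ n n', b n n' = ∑ i, b (v i) (v i) * (v.coord i n * v.coord i n') := fun n n' => by
    rw [← LinearMap.BilinForm.sum_repr_mul_repr_mul v, Finsupp.sum_fintype _ _ (by simp)]
    refine Finset.sum_congr rfl fun i _ => ?_
    rw [Finsupp.sum_fintype _ _ (by simp), Finset.sum_eq_single i]
    · simp only [smul_eq_mul, Module.Basis.coord_apply]
      ring
    · intro j _ hj
      have : b (v i) (v j) = 0 := hv hj.symm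
      simp [this]
    · simp
  generalize Module.finrank ℝ W = m at hW v hv
  interval_cases m
  · exact ⟨0, 0, 0, 0, fun n n' => by rw [h]; simp⟩
  · exact ⟨b (v 0) (v 0), 0, v.coord 0, 0, fun n n' => by
      rw [h, Fin.sum_univ_one, zero_mul, add_zero]⟩
  · exact ⟨b (v 0) (v 0), b (v 1) (v 1), v.coord 0, v.coord 1, fun n n' => by
      rw [h, Fin.sum_univ_two]⟩

section Gauss

variable {E F : Type} [NormedAddCommGroup E] [NormedSpace ℝ E] [FiniteDimensional ℝ E]
  [NormedAddCommGroup F] [NormedSpace ℝ F] [FiniteDimensional ℝ F]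
  {f : E → F} {G : E → E →L[ℝ] E →L[ℝ] ℝ} {B : F →L[ℝ] F →L[ℝ] ℝ}

/-- `B` is positive on the tangent space `T`, so the orthogonal space `W` meets it only in zero and
has dimension at most two. Diagonalising `B` on `W` splits the second fundamental form into the two
matrices. -/
theorem exists_solvesGauss_of_induced (hf : ContDiff ℝ ∞ f)
    (hG : ∀ z u v, G z u v = B (fderiv ℝ f z u) (fderiv ℝ f z v)) (hB : ∀ a b, B a b = B b a)
    {y : E} (hpos : ∀ u, u ≠ 0 → 0 < G y u u)
    (hdim : Module.finrank ℝ F ≤ Module.finrank ℝ E + 2) (e : Fin 4 → E) :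
    ∃ ε₁ ε₂ : ℝ, ∃ K L : Matrix (Fin 4) (Fin 4) ℝ,
      SolvesGauss (fun i j k l => riemannCoord G y (e i) (e j) (e k) (e l)) ε₁ ε₂ K L := by
  set T : Submodule ℝ F := LinearMap.range (fderiv ℝ f y : E →ₗ[ℝ] F) with hT
  let W : Submodule ℝ F :=
    { carrier := {n | ∀ w, B n (fderiv ℝ f y w) = 0}
      add_mem' := fun {a b} ha hb w => by rw [map_add, add_apply, ha w, hb w, add_zero]
      zero_mem' := fun w => by simp
      smul_mem' := fun c a ha w => by rw [map_smul, smul_apply, ha w, smul_zero] }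
  have hinj : Function.Injective (fderiv ℝ f y : E →ₗ[ℝ] F) := by
    refine (injective_iff_map_eq_zero _).mpr fun u hu => ?_
    by_contra hne
    have h1 := hpos u hne
    have hu' : fderiv ℝ f y u = 0 := hu
    rw [hG, hu', map_zero] at h1
    exact lt_irrefl _ h1
  have hdisj : Disjoint T W := by
    rw [Submodule.disjoint_def]
    rintro _ ⟨u, rfl⟩ hW
    by_contra hne
    have hu : u ≠ 0 := fun h => hne (by rw [h, map_zero])
    have h1 := hpos u hu
    rw [hG] at h1
    exact h1.ne' (hW u)
  have hW2 : Module.finrank ℝ W ≤ 2 := by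
    have h1 := Submodule.finrank_add_finrank_le_of_disjoint hdisj
    rw [hT, LinearMap.finrank_range_of_inj hinj] at h1
    omega
  let b : LinearMap.BilinForm ℝ W :=
    LinearMap.mk₂ ℝ (fun m n : W => B m n) (by simp) (by simp) (by simp) (by simp)
  have hb : b.IsSymm := ⟨fun m n => hB m n⟩
  obtain ⟨ε₁, ε₂, φ, ψ, h⟩ := exists_eq_add_of_finrank_le_two b hb hW2
  let N : E → E → W := fun u v => ⟨secondFundamental f G y u v,
    fun w => apply_secondFundamental hf hG hB hpos u v w⟩
  have hNs : ∀ u v, N u v = N v u := fun u v =>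
    Subtype.ext (secondFundamental_comm hf hG hB hpos u v)
  refine ⟨ε₁, ε₂, Matrix.of fun i j => φ (N (e i) (e j)), Matrix.of fun i j => ψ (N (e i) (e j)),
    ?_, ?_, fun i j k l => ?_⟩
  · ext i j
    exact congrArg φ (hNs _ _)
  · ext i j
    exact congrArg ψ (hNs _ _)
  · have hR := riemannCoord_induced hf hG hB hpos (e i) (e j) (e k) (e l)
    have h1 := h (N (e i) (e k)) (N (e j) (e l))
    have h2 := h (N (e i) (e l)) (N (e j) (e k))
    have e1 : b (N (e i) (e k)) (N (e j) (e l)) =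
      B (secondFundamental f G y (e i) (e k)) (secondFundamental f G y (e j) (e l)) := rfl
    have e2 : b (N (e i) (e l)) (N (e j) (e k)) =
      B (secondFundamental f G y (e i) (e l)) (secondFundamental f G y (e j) (e k)) := rfl
    simp only [Matrix.of_apply]
    rw [hR, ← e1, ← e2, h1, h2]
    ring

end Gauss

/-- The flat metric of `ℝ^{r,s}` as a continuous bilinear form. -/
def flatCLM (r s : ℕ) : PseudoEuclidean r s →L[ℝ] PseudoEuclidean r s →L[ℝ] ℝ :=
  (innerSL ℝ).bilinearComp (ContinuousLinearMap.fst ℝ _ _) (ContinuousLinearMap.fst ℝ _ _)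
    - (innerSL ℝ).bilinearComp (ContinuousLinearMap.snd ℝ _ _) (ContinuousLinearMap.snd ℝ _ _)

theorem flatCLM_apply {r s : ℕ} (x y : PseudoEuclidean r s) : flatCLM r s x y = flatForm x y := rfl

theorem flatForm_comm {r s : ℕ} (x y : PseudoEuclidean r s) : flatForm x y = flatForm y x := by
  rw [flatForm, flatForm, real_inner_comm x.1, real_inner_comm x.2]

end RiemGeom

/-! ### Nonexistence of embeddings in codimension at most two -/

namespace TautBundle

open RiemGeom ComplexConjugate

theorem exists_frame (p : TautBundle) :
    ∃ e : Fin 4 → TangentSpace 𝓘(ℝ, ℂ × ℂ) p, IsFrame burnsMetric p e := by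
  set x := chartAt (ℂ × ℂ) p p with hx
  have hD := (den_pos x).ne'
  have hs := (Real.sqrt_pos.mpr (den_pos x)).ne'
  have hN := (Real.sqrt_pos.mpr (onePlusRhoSq_pos x)).ne'
  have h : ∀ a b : ℂ, ∃ u : ℂ × ℂ, xiForm x u = a ∧ etaForm x u = b := fun a b => by
    refine ⟨((√(den x))⁻¹ • a - (den x)⁻¹ • (x.1 * conj x.2 * ((√(onePlusRhoSq x))⁻¹ * den x) • b),
      ((√(onePlusRhoSq x))⁻¹ * den x) • b), ?_, ?_⟩
    · simp only [xiForm]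
      rw [sub_add_cancel, smul_smul, mul_inv_cancel₀ hs, one_smul]
    · simp only [etaForm]
      rw [smul_smul]
      have : √(onePlusRhoSq x) * (den x)⁻¹ * ((√(onePlusRhoSq x))⁻¹ * den x) = 1 := by field_simp
      rw [this, one_smul]
  obtain ⟨u0, h00, h01⟩ := h 1 0
  obtain ⟨u1, h10, h11⟩ := h Complex.I 0
  obtain ⟨u2, h20, h21⟩ := h 0 1
  obtain ⟨u3, h30, h31⟩ := h 0 Complex.I
  refine ⟨fun i => (![u0, u1, u2, u3] i : ℂ × ℂ), fun i j => ?_⟩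
  refine (burnsForm_eq_xiForm_add_etaForm x _ _).trans ?_
  fin_cases i <;> fin_cases j <;>
    simp [h00, h01, h10, h11, h20, h21, h30, h31, Complex.inner]

theorem contDiff_comp_chart_symm {V : Type} [NormedAddCommGroup V] [NormedSpace ℝ V]
    {f : TautBundle → V} (hf : ContMDiff 𝓘(ℝ, ℂ × ℂ) 𝓘(ℝ, V) ∞ f) (p : TautBundle) :
    ContDiff ℝ ∞ (f ∘ (chartAt (ℂ × ℂ) p).symm) := by
  have h : ContMDiffOn 𝓘(ℝ, ℂ × ℂ) 𝓘(ℝ, ℂ × ℂ) ∞ (chartAt (ℂ × ℂ) p).symm Set.univ :=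
    contMDiffOn_chart_symm
  exact (hf.comp (contMDiffOn_univ.mp h)).contDiff

/-- The inverse chart is defined on the whole model space, so the identity holds at every `y` and
can be differentiated freely. -/
theorem burnsForm_eq_flatForm {r s : ℕ} {f : TautBundle → PseudoEuclidean r s}
    (hf : IsIsometricEmbedding burnsMetric f) (p : TautBundle) (y u v : ℂ × ℂ) :
    burnsForm y u v = flatCLM r s (fderiv ℝ (f ∘ (chartAt (ℂ × ℂ) p).symm) y u)
      (fderiv ℝ (f ∘ (chartAt (ℂ × ℂ) p).symm) y v) := by
  have hm : MDifferentiableAt 𝓘(ℝ, ℂ × ℂ) 𝓘(ℝ, ℂ × ℂ) (chartAt (ℂ × ℂ) p).symm y :=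
    mdifferentiableAt_atlas_symm (chart_mem_atlas _ p) (Set.mem_univ y)
  have hfm := hf.contMDiff.mdifferentiableAt (x := (chartAt (ℂ × ℂ) p).symm y) (by simp)
  have hc := mfderiv_comp y hfm hm
  rw [mfderiv_eq_fderiv] at hc
  rw [flatCLM_apply, hc, ← metricInChart_burnsMetric p]
  exact (hf.pullback _ _ _).symm

theorem not_isIsometricEmbedding {r s : ℕ} (h : r + s ≤ 6) (f : TautBundle → PseudoEuclidean r s) :
    ¬ IsIsometricEmbedding burnsMetric f := by
  intro hf
  -- The obstruction is pointwise and present everywhere, so any point would serve.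
  let p : TautBundle := ofChart 0 0
  obtain ⟨e, he⟩ := exists_frame p
  have hdim : Module.finrank ℝ (PseudoEuclidean r s) ≤ Module.finrank ℝ (ℂ × ℂ) + 2 := by
    simp only [Module.finrank_prod, finrank_euclideanSpace, Fintype.card_fin,
      Complex.finrank_real_complex]
    omega
  obtain ⟨ε₁, ε₂, K, L, hKL⟩ := exists_solvesGauss_of_induced
    (contDiff_comp_chart_symm hf.contMDiff p) (burnsForm_eq_flatForm hf p)
    (fun a b => flatForm_comm a b) (burnsForm_pos (chartAt (ℂ × ℂ) p p)) hdim e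
  refine (isBurnsLike_riemannFrame p e he).not_solvesGauss ε₁ ε₂ ⟨K, L, ?_⟩
  have hR : riemannFrame burnsMetric p e = fun i j k l =>
      riemannCoord burnsForm (chartAt (ℂ × ℂ) p p) (e i) (e j) (e k) (e l) := by
    funext i j k l
    rw [riemannFrame, riemann, metricInChart_burnsMetric]
  rw [hR]
  exact hKL

end TautBundle

/-! ### The Hopf identification of the projective line with the sphere -/

namespace TautBundle

open RiemGeom ComplexConjugate

/-- The Hopf map on nonzero vectors of `ℂ²`, onto the round sphere of radius `1/2`. -/
def hopf (z : Fin 2 → ℂ) : EuclideanSpace ℝ (Fin 3) :=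
  !₂[(conj (z 0) * z 1).re / (‖z 0‖ ^ 2 + ‖z 1‖ ^ 2),
    (conj (z 0) * z 1).im / (‖z 0‖ ^ 2 + ‖z 1‖ ^ 2),
    (‖z 0‖ ^ 2 - ‖z 1‖ ^ 2) / (2 * (‖z 0‖ ^ 2 + ‖z 1‖ ^ 2))]

theorem hopf_smul {c : ℂ} (hc : c ≠ 0) (z : Fin 2 → ℂ) : hopf (c • z) = hopf z := by
  have hn : ‖c‖ ^ 2 ≠ 0 := pow_ne_zero 2 (norm_ne_zero_iff.mpr hc)
  have h0 : conj (c * z 0) * (c * z 1) = (‖c‖ ^ 2 : ℝ) * (conj (z 0) * z 1) := by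
    rw [Complex.ofReal_pow, ← Complex.conj_mul', map_mul]
    ring
  have h1 : ‖c * z 0‖ ^ 2 + ‖c * z 1‖ ^ 2 = ‖c‖ ^ 2 * (‖z 0‖ ^ 2 + ‖z 1‖ ^ 2) := by
    rw [norm_mul, norm_mul]
    ring
  have h2 : ‖c * z 0‖ ^ 2 - ‖c * z 1‖ ^ 2 = ‖c‖ ^ 2 * (‖z 0‖ ^ 2 - ‖z 1‖ ^ 2) := by
    rw [norm_mul, norm_mul]
    ring
  simp only [hopf, Pi.smul_apply, smul_eq_mul]
  rw [h0, h1, h2, Complex.re_ofReal_mul, Complex.im_ofReal_mul, mul_div_mul_left _ _ hn,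
    mul_div_mul_left _ _ hn, mul_left_comm 2, mul_div_mul_left _ _ hn]

/-- The identification of the complex projective line with the sphere of radius `1/2`. -/
def lineToSphere (L : ℙ ℂ (Fin 2 → ℂ)) : EuclideanSpace ℝ (Fin 3) := hopf L.rep

theorem lineToSphere_mk (z : Fin 2 → ℂ) (hz : z ≠ 0) :
    lineToSphere (Projectivization.mk ℂ z hz) = hopf z := by
  obtain ⟨a, ha⟩ := Projectivization.exists_smul_eq_mk_rep ℂ z hz
  rw [lineToSphere, ← ha]
  exact hopf_smul a.ne_zero z

theorem hopf_affineVec_zero (w : ℂ) : hopf (affineVec 0 w) =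
    !₂[w.re / (1 + ‖w‖ ^ 2), w.im / (1 + ‖w‖ ^ 2), (1 + ‖w‖ ^ 2)⁻¹ - 1 / 2] := by
  have h : 1 + ‖w‖ ^ 2 ≠ 0 := by positivity
  simp [hopf, affineVec]
  field_simp
  ring

theorem hopf_affineVec_one (w : ℂ) : hopf (affineVec 1 w) =
    !₂[w.re / (1 + ‖w‖ ^ 2), -(w.im / (1 + ‖w‖ ^ 2)), 1 / 2 - (1 + ‖w‖ ^ 2)⁻¹] := by
  have h : 1 + ‖w‖ ^ 2 ≠ 0 := by positivity
  simp [hopf, affineVec, add_comm (‖w‖ ^ 2), neg_div]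
  field_simp
  ring

theorem line_eq_mk_affineVec (L : ℙ ℂ (Fin 2 → ℂ)) : (∃ w, L =
    Projectivization.mk ℂ (affineVec 0 w) (affineVec_ne_zero 0 w)) ∨
    L = Projectivization.mk ℂ (affineVec 1 0) (affineVec_ne_zero 1 0) := by
  by_cases h : L.rep 0 = 0
  · right
    rw [← L.mk_rep, Projectivization.mk_eq_mk_iff']
    refine ⟨L.rep 1, funext fun k => ?_⟩
    fin_cases k <;> simp [affineVec, h]
  · left
    refine ⟨L.rep 1 / L.rep 0, ?_⟩
    rw [← L.mk_rep, Projectivization.mk_eq_mk_iff']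
    refine ⟨L.rep 0, funext fun k => ?_⟩
    rw [L.mk_rep]
    fin_cases k <;> simp [affineVec]
    field_simp

theorem lineToSphere_affineVec (w : ℂ) :
    lineToSphere (Projectivization.mk ℂ (affineVec 0 w) (affineVec_ne_zero 0 w)) =
    !₂[w.re / (1 + ‖w‖ ^ 2), w.im / (1 + ‖w‖ ^ 2), (1 + ‖w‖ ^ 2)⁻¹ - 1 / 2] := by
  rw [lineToSphere_mk, hopf_affineVec_zero]

theorem lineToSphere_infinity :
    lineToSphere (Projectivization.mk ℂ (affineVec 1 0) (affineVec_ne_zero 1 0)) =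
    !₂[0, 0, -1 / 2] := by
  rw [lineToSphere_mk, hopf_affineVec_one]
  norm_num

/-- In the affine coordinate this is inverse stereographic projection: the height gives (1 +
|w|²)⁻¹, which then recovers `w`. Only the line at infinity makes this quantity zero. -/
theorem lineToSphere_injective : Function.Injective lineToSphere := by
  have hne : ∀ w : ℂ, (1 + ‖w‖ ^ 2)⁻¹ ≠ 0 := fun w => by positivity
  intro L L' h
  rcases line_eq_mk_affineVec L with ⟨w, rfl⟩ | rfl <;>
    rcases line_eq_mk_affineVec L' with ⟨w', rfl⟩ | rfl
  · rw [lineToSphere_affineVec, lineToSphere_affineVec] at h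
    have h0 := congrArg (fun v => v 0) h
    have h1 := congrArg (fun v => v 1) h
    have h2 := congrArg (fun v => v 2) h
    simp [div_eq_mul_inv] at h0 h1 h2
    rw [h2] at h0 h1
    congr 2
    refine Complex.ext (mul_right_cancel₀ (hne w') h0) (mul_right_cancel₀ (hne w') h1)
  · rw [lineToSphere_affineVec, lineToSphere_infinity] at h
    have h2 := congrArg (fun v => v 2) h
    simp at h2
    exact absurd (by linarith) (hne w)
  · rw [lineToSphere_affineVec, lineToSphere_infinity] at h
    have h2 := congrArg (fun v => v 2) h
    simp at h2
    exact absurd (by linarith) (hne w')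
  · rfl

theorem range_lineToSphere : Set.range lineToSphere = Metric.sphere 0 (1 / 2) := by
  have hsph : ∀ v : EuclideanSpace ℝ (Fin 3), v ∈ Metric.sphere 0 (1 / 2) ↔
      v 0 ^ 2 + v 1 ^ 2 + v 2 ^ 2 = 1 / 4 := fun v => by
    rw [mem_sphere_zero_iff_norm, EuclideanSpace.norm_eq, Fin.sum_univ_three,
      Real.sqrt_eq_iff_mul_self_eq (by positivity) (by norm_num)]
    simp only [Real.norm_eq_abs, sq_abs]
    constructor <;> intro h <;> linarith
  ext v
  rw [hsph]
  constructor
  · rintro ⟨L, rfl⟩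
    rcases line_eq_mk_affineVec L with ⟨w, rfl⟩ | rfl
    · rw [lineToSphere_affineVec]
      have h : 1 + (w.re * w.re + w.im * w.im) ≠ 0 :=
        (add_pos_of_pos_of_nonneg one_pos (add_nonneg (mul_self_nonneg _) (mul_self_nonneg _))).ne'
      rw [Complex.sq_norm, Complex.normSq_apply]
      simp
      field_simp
      ring
    · rw [lineToSphere_infinity]
      simp
      norm_num
  · intro h
    by_cases h2 : v 2 = -1 / 2
    · refine ⟨_, lineToSphere_infinity.trans ?_⟩
      rw [h2] at h
      have h0 : v 0 = 0 := by nlinarith [sq_nonneg (v 0), sq_nonneg (v 1)]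
      have h1 : v 1 = 0 := by nlinarith [sq_nonneg (v 0), sq_nonneg (v 1)]
      ext k
      fin_cases k <;> simp [h0, h1, h2]
    -- Here `c` plays the role of (1 + |w|²)⁻¹, so stereographic projection gives w = (v₀ + i v₁)/c.
    · obtain ⟨c, hc⟩ : ∃ c, v 2 = c - 1 / 2 := ⟨v 2 + 1 / 2, by ring⟩
      have hs : c ≠ 0 := fun h' => h2 (by rw [hc, h']; norm_num)
      refine ⟨_, (lineToSphere_affineVec ⟨v 0 / c, v 1 / c⟩).trans ?_⟩
      have hn : 1 + ‖(⟨v 0 / c, v 1 / c⟩ : ℂ)‖ ^ 2 = c⁻¹ := by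
        rw [Complex.sq_norm, Complex.normSq_apply]
        rw [hc] at h
        field_simp
        linarith
      rw [hn]
      ext k
      fin_cases k
      · simp
        field_simp
      · simp
        field_simp
      · simp [hc]

end TautBundle

/-! ### The isometric embedding into seven-dimensional Euclidean space -/

namespace TautBundle

open RiemGeom ComplexConjugate
open scoped Topology

/-- The blow-down map together with the projection to the sphere. -/
def embed (p : TautBundle) : PseudoEuclidean 7 0 :=
  (!₂[(p.vec 0).re, (p.vec 0).im, (p.vec 1).re, (p.vec 1).im,
    lineToSphere p.line 0, lineToSphere p.line 1, lineToSphere p.line 2], 0)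

theorem embed_ofChart_zero (x : ℂ × ℂ) : embed (ofChart 0 x) =
    (!₂[x.1.re, x.1.im, (x.1 * x.2).re, (x.1 * x.2).im, ((den x ^ 1)⁻¹ • x.2).re,
      ((den x ^ 1)⁻¹ • x.2).im, (den x ^ 1)⁻¹ - 1 / 2], 0) := by
  have h : lineToSphere (ofChart 0 x).line = _ := lineToSphere_affineVec x.2
  rw [embed, h]
  refine Prod.ext ?_ rfl
  ext k
  fin_cases k <;> simp [-Complex.real_smul, Complex.smul_re, Complex.smul_im, ofChart, affineVec,
    den, div_eq_inv_mul]

theorem embed_ofChart_one (x : ℂ × ℂ) : embed (ofChart 1 x) =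
    (!₂[(x.1 * x.2).re, (x.1 * x.2).im, x.1.re, x.1.im, ((den x ^ 1)⁻¹ • x.2).re,
      -((den x ^ 1)⁻¹ • x.2).im, 1 / 2 - (den x ^ 1)⁻¹], 0) := by
  have h : lineToSphere (ofChart 1 x).line = _ :=
    (lineToSphere_mk _ _).trans (hopf_affineVec_one x.2)
  rw [embed, h]
  refine Prod.ext ?_ rfl
  ext k
  fin_cases k <;> simp [-Complex.real_smul, Complex.smul_re, Complex.smul_im, ofChart, affineVec,
    den, div_eq_inv_mul]

/-- The derivative of `1 / den`. -/
def denInvDeriv (x : ℂ × ℂ) : ℂ × ℂ →L[ℝ] ℝ :=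
  (-2 * (den x ^ 2)⁻¹ : ℝ) • (innerSL ℝ x.2).comp (ContinuousLinearMap.snd ℝ ℂ ℂ)

set_option synthInstance.maxHeartbeats 200000 in
theorem hasFDerivAt_den_inv (x : ℂ × ℂ) :
    HasFDerivAt (fun z => (den z ^ 1)⁻¹) (denInvDeriv x) x := by
  refine (hasFDerivAt_den_inv_pow 1 x).congr_fderiv ?_
  rw [denInvDeriv]
  norm_num

theorem hasFDerivAt_mul_coord (x : ℂ × ℂ) :
    HasFDerivAt (fun z : ℂ × ℂ => z.1 * z.2) (prodDeriv x) x := by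
  refine ((hasFDerivAt_fst (𝕜 := ℝ) (p := x)).mul
    (hasFDerivAt_snd (𝕜 := ℝ) (p := x))).congr_fderiv ?_
  ext u <;> simp [prodDeriv]

theorem hasFDerivAt_den_inv_smul (x : ℂ × ℂ) :
    HasFDerivAt (fun z : ℂ × ℂ => (den z ^ 1)⁻¹ • z.2)
      ((den x ^ 1)⁻¹ • ContinuousLinearMap.snd ℝ ℂ ℂ + (denInvDeriv x).smulRight x.2) x :=
  (hasFDerivAt_den_inv x).smul hasFDerivAt_snd

/-- The pull-back of the flat metric of `ℝ^7` in terms of the coordinates of a map. -/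
theorem exists_hasFDerivAt_of_coord {F : ℂ × ℂ → PseudoEuclidean 7 0} {x : ℂ × ℂ}
    (c : Fin 7 → ℂ × ℂ →L[ℝ] ℝ) (h : ∀ k, HasFDerivAt (fun z => (F z).1 k) (c k) x) :
    ∃ F' : ℂ × ℂ →L[ℝ] PseudoEuclidean 7 0, HasFDerivAt F F' x ∧
      ∀ u v, flatForm (F' u) (F' v) = ∑ k, c k u * c k v := by
  obtain ⟨L, hL⟩ : ∃ L : ℂ × ℂ →L[ℝ] EuclideanSpace ℝ (Fin 7), ∀ u k, L u k = c k u :=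
    ⟨(PiLp.continuousLinearEquiv 2 ℝ fun _ : Fin 7 => ℝ).symm.toContinuousLinearMap.comp
      (ContinuousLinearMap.pi c), fun _ _ => rfl⟩
  refine ⟨L.prod 0, ?_, fun u v => ?_⟩
  · refine HasFDerivAt.prodMk (f₁ := fun z => (F z).1) (f₂ := fun z => (F z).2) ?_ ?_
    · refine hasFDerivWithinAt_univ.mp (hasFDerivWithinAt_euclidean.mpr fun k =>
        hasFDerivWithinAt_univ.mpr ((h k).congr_fderiv (ContinuousLinearMap.ext fun u => ?_)))
      exact (hL u k).symm
    · refine (hasFDerivAt_const 0 x).congr_of_eventuallyEq (Filter.Eventually.of_forall fun z => ?_)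
      exact Subsingleton.elim _ _
  · simp only [flatForm, ContinuousLinearMap.prod_apply, PiLp.inner_apply, hL]
    simp [mul_comm]

-- Inverse stereographic projection is conformal, with factor `(den x ^ 2)⁻¹` on the sphere of
-- radius 1/2.
set_option synthInstance.maxHeartbeats 200000 in
theorem inner_sphere_deriv (x u v : ℂ × ℂ) (D' : ℂ × ℂ →L[ℝ] ℂ)
    (hD' : D' = (den x ^ 1)⁻¹ • ContinuousLinearMap.snd ℝ ℂ ℂ + (denInvDeriv x).smulRight x.2) :
    (D' u).re * (D' v).re + (D' u).im * (D' v).im + denInvDeriv x u * denInvDeriv x v =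
      (den x ^ 2)⁻¹ * inner ℝ u.2 v.2 := by
  have hD := (den_pos x).ne'
  have h : den x = 1 + (x.2.re * x.2.re + x.2.im * x.2.im) := by
    rw [den, Complex.sq_norm, Complex.normSq_apply]
  have hu : ∀ u, D' u = (den x)⁻¹ • u.2 + denInvDeriv x u • x.2 := fun u => by
    rw [hD', pow_one]
    rfl
  have hd : ∀ u, denInvDeriv x u = -2 * (den x ^ 2)⁻¹ * (x.2.re * u.2.re + x.2.im * u.2.im) :=
    fun u => by
      have h0 : denInvDeriv x u = -2 * (den x ^ 2)⁻¹ * inner ℝ x.2 u.2 := rfl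
      rw [h0, Complex.inner, Complex.mul_re, Complex.conj_re, Complex.conj_im]
      ring
  simp only [hu, hd, Complex.add_re, Complex.add_im, Complex.smul_re, Complex.smul_im, smul_eq_mul,
    Complex.inner, Complex.mul_re, Complex.conj_re, Complex.conj_im]
  clear hu hd hD'
  generalize den x = D at *
  field_simp
  rw [h]
  ring

/-- The two charts differ in ℝ⁷ by a permutation of coordinates and two sign changes, so the same
sum of squares gives the metric in both. -/
theorem exists_hasFDerivAt_embed_ofChart (i : Fin 2) (x : ℂ × ℂ) :
    ∃ F' : ℂ × ℂ →L[ℝ] PseudoEuclidean 7 0, HasFDerivAt (fun z => embed (ofChart i z)) F' x ∧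
      ∀ u v, flatForm (F' u) (F' v) = burnsForm x u v := by
  have h1 := hasFDerivAt_fst (𝕜 := ℝ) (p := x)
  have h2 := hasFDerivAt_mul_coord x
  have h3 := hasFDerivAt_den_inv_smul x
  have h4 := hasFDerivAt_den_inv x
  have hi := inner_sphere_deriv x
  set D' : ℂ × ℂ →L[ℝ] ℂ :=
    (den x ^ 1)⁻¹ • ContinuousLinearMap.snd ℝ ℂ ℂ + (denInvDeriv x).smulRight x.2 with hD'
  have hre : ∀ {f : ℂ × ℂ → ℂ} {f' : ℂ × ℂ →L[ℝ] ℂ}, HasFDerivAt f f' x →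
      HasFDerivAt (fun z => (f z).re) (Complex.reCLM.comp f') x := fun h =>
    Complex.reCLM.hasFDerivAt.comp x h
  have him : ∀ {f : ℂ × ℂ → ℂ} {f' : ℂ × ℂ →L[ℝ] ℂ}, HasFDerivAt f f' x →
      HasFDerivAt (fun z => (f z).im) (Complex.imCLM.comp f') x := fun h =>
    Complex.imCLM.hasFDerivAt.comp x h
  have hsum : ∀ u v, inner ℝ u.1 v.1 + inner ℝ (prodDeriv x u) (prodDeriv x v) +
      ((D' u).re * (D' v).re + (D' u).im * (D' v).im + denInvDeriv x u * denInvDeriv x v) =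
      burnsForm x u v := fun u v => by
    rw [hi u v D' rfl, burnsForm_apply]
    simp [prodDeriv, den]
  fin_cases i
  · obtain ⟨F', hF, hF'⟩ := exists_hasFDerivAt_of_coord (F := fun z => embed (ofChart 0 z)) (x := x)
      ![Complex.reCLM.comp (ContinuousLinearMap.fst ℝ ℂ ℂ),
        Complex.imCLM.comp (ContinuousLinearMap.fst ℝ ℂ ℂ), Complex.reCLM.comp (prodDeriv x),
        Complex.imCLM.comp (prodDeriv x), Complex.reCLM.comp D', Complex.imCLM.comp D',
        denInvDeriv x] (by
        simp only [embed_ofChart_zero]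
        intro k
        fin_cases k
        exacts [hre h1, him h1, hre h2, him h2, hre h3, him h3, h4.sub_const _])
    refine ⟨F', hF, fun u v => ?_⟩
    rw [hF', ← hsum]
    simp [Fin.sum_univ_succ, Complex.inner]
    ring
  · obtain ⟨F', hF, hF'⟩ := exists_hasFDerivAt_of_coord (F := fun z => embed (ofChart 1 z)) (x := x)
      ![Complex.reCLM.comp (prodDeriv x), Complex.imCLM.comp (prodDeriv x),
        Complex.reCLM.comp (ContinuousLinearMap.fst ℝ ℂ ℂ),
        Complex.imCLM.comp (ContinuousLinearMap.fst ℝ ℂ ℂ), Complex.reCLM.comp D',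
        -Complex.imCLM.comp D', -denInvDeriv x] (by
        simp only [embed_ofChart_one]
        intro k
        fin_cases k
        exacts [hre h2, him h2, hre h1, him h1, hre h3, (him h3).neg, h4.const_sub _])
    refine ⟨F', hF, fun u v => ?_⟩
    rw [hF', ← hsum]
    simp [Fin.sum_univ_succ, Complex.inner]
    ring

theorem contDiff_embed_ofChart (i : Fin 2) : ContDiff ℝ ∞ fun z => embed (ofChart i z) := by
  have hd : ContDiff ℝ ∞ fun z : ℂ × ℂ => (den z ^ 1)⁻¹ := by
    refine ContDiff.inv ?_ fun z => pow_ne_zero 1 (den_pos z).ne'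
    exact (contDiff_const.add (contDiff_snd.norm_sq ℝ)).pow 1
  have h1 : ContDiff ℝ ∞ fun z : ℂ × ℂ => z.1 := contDiff_fst
  have h2 : ContDiff ℝ ∞ fun z : ℂ × ℂ => z.1 * z.2 := contDiff_fst.mul contDiff_snd
  have h3 : ContDiff ℝ ∞ fun z : ℂ × ℂ => (den z ^ 1)⁻¹ • z.2 := hd.smul contDiff_snd
  have hre : ∀ {f : ℂ × ℂ → ℂ}, ContDiff ℝ ∞ f → ContDiff ℝ ∞ fun z => (f z).re := fun h =>
    Complex.reCLM.contDiff.comp h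
  have him : ∀ {f : ℂ × ℂ → ℂ}, ContDiff ℝ ∞ f → ContDiff ℝ ∞ fun z => (f z).im := fun h =>
    Complex.imCLM.contDiff.comp h
  fin_cases i
  · simp only [Fin.zero_eta, embed_ofChart_zero]
    refine ContDiff.prodMk (contDiff_euclidean.mpr fun k => ?_) contDiff_const
    fin_cases k
    exacts [hre h1, him h1, hre h2, him h2, hre h3, him h3, hd.sub contDiff_const]
  · simp only [Fin.mk_one, embed_ofChart_one]
    refine ContDiff.prodMk (contDiff_euclidean.mpr fun k => ?_) contDiff_const
    fin_cases k
    exacts [hre h2, him h2, hre h1, him h1, hre h3, (him h3).neg, contDiff_const.sub hd]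

theorem embed_eventuallyEq (p : TautBundle) :
    embed =ᶠ[𝓝 p] fun q => embed (ofChart p.chartIndex (chartAt (ℂ × ℂ) p q)) := by
  filter_upwards [(chartAt (ℂ × ℂ) p).open_source.mem_nhds (mem_chart_source _ p)] with q hq
  exact (congrArg embed ((chartAt (ℂ × ℂ) p).left_inv hq)).symm

theorem contMDiff_embed : ContMDiff 𝓘(ℝ, ℂ × ℂ) 𝓘(ℝ, PseudoEuclidean 7 0) ∞ embed := by
  intro p
  have h2 : ContMDiffAt 𝓘(ℝ, ℂ × ℂ) 𝓘(ℝ, ℂ × ℂ) ∞ (chartAt (ℂ × ℂ) p) p := contMDiffAt_extChartAt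
  have h3 := (contDiff_embed_ofChart p.chartIndex).contMDiff.contMDiffAt.comp p h2
  exact h3.congr_of_eventuallyEq (embed_eventuallyEq p)

theorem embed_pullback (p : TautBundle) (u v : TangentSpace 𝓘(ℝ, ℂ × ℂ) p) :
    flatForm (mfderiv 𝓘(ℝ, ℂ × ℂ) 𝓘(ℝ, PseudoEuclidean 7 0) embed p u)
      (mfderiv 𝓘(ℝ, ℂ × ℂ) 𝓘(ℝ, PseudoEuclidean 7 0) embed p v) = burnsMetric.inner p u v := by
  obtain ⟨F', hF, hF'⟩ := exists_hasFDerivAt_embed_ofChart p.chartIndex (chartAt (ℂ × ℂ) p p)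
  have h : HasMFDerivAt 𝓘(ℝ, ℂ × ℂ) 𝓘(ℝ, PseudoEuclidean 7 0) embed p F' :=
    ⟨contMDiff_embed.continuous.continuousAt, hF.hasFDerivWithinAt⟩
  rw [h.mfderiv]
  exact hF' u v

theorem embed_injective : Function.Injective embed := by
  intro p q h
  have hk : ∀ k, (embed p).1 k = (embed q).1 k := fun k => by rw [h]
  have hl : p.line = q.line := by
    refine lineToSphere_injective ?_
    ext k
    fin_cases k
    exacts [hk 4, hk 5, hk 6]
  have hv : p.vec = q.vec := by
    funext k
    fin_cases k
    exacts [Complex.ext (hk 0) (hk 1), Complex.ext (hk 2) (hk 3)]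
  cases p
  cases q
  simp_all

theorem norm_sq_add_norm_sq_ne_zero {z : Fin 2 → ℂ} (hz : z ≠ 0) :
    ‖z 0‖ ^ 2 + ‖z 1‖ ^ 2 ≠ 0 := by
  intro h
  apply hz
  have h0 : ‖z 0‖ ^ 2 = 0 := by nlinarith [sq_nonneg ‖z 0‖, sq_nonneg ‖z 1‖]
  have h1 : ‖z 1‖ ^ 2 = 0 := by nlinarith [sq_nonneg ‖z 0‖, sq_nonneg ‖z 1‖]
  funext k
  fin_cases k
  · simpa using h0
  · simpa using h1

/-- The charts factor through `embed`. -/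
theorem exists_chart_factor (i : Fin 2) : ∃ (c : PseudoEuclidean 7 0 → ℝ)
    (φ : PseudoEuclidean 7 0 → ℂ × ℂ), Continuous c ∧ (∀ v, c v ≠ 0 → ContinuousAt φ v) ∧
      (∀ q : TautBundle, c (embed q) ≠ 0 ↔ q.line.rep i ≠ 0) ∧
      ∀ q : TautBundle, q.line.rep i ≠ 0 → φ (embed q) = chart i q := by
  have hk : ∀ k, Continuous fun v : PseudoEuclidean 7 0 => v.1 k := fun k => by fun_prop
  have hC : ∀ k, Continuous fun v : PseudoEuclidean 7 0 => ((v.1 k : ℝ) : ℂ) := fun k =>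
    Complex.continuous_ofReal.comp (hk k)
  have hN : ∀ q : TautBundle, ‖q.line.rep 0‖ ^ 2 + ‖q.line.rep 1‖ ^ 2 ≠ 0 := fun q =>
    norm_sq_add_norm_sq_ne_zero q.line.rep_nonzero
  have h4 : ∀ q : TautBundle, (embed q).1 4 = (conj (q.line.rep 0) * q.line.rep 1).re /
    (‖q.line.rep 0‖ ^ 2 + ‖q.line.rep 1‖ ^ 2) := fun _ => rfl
  have h5 : ∀ q : TautBundle, (embed q).1 5 = (conj (q.line.rep 0) * q.line.rep 1).im /
    (‖q.line.rep 0‖ ^ 2 + ‖q.line.rep 1‖ ^ 2) := fun _ => rfl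
  have h6 : ∀ q : TautBundle, (embed q).1 6 = (‖q.line.rep 0‖ ^ 2 - ‖q.line.rep 1‖ ^ 2) /
    (2 * (‖q.line.rep 0‖ ^ 2 + ‖q.line.rep 1‖ ^ 2)) := fun _ => rfl
  fin_cases i
  · have hc : ∀ q : TautBundle, (embed q).1 6 + 1 / 2 =
        ‖q.line.rep 0‖ ^ 2 / (‖q.line.rep 0‖ ^ 2 + ‖q.line.rep 1‖ ^ 2) := fun q => by
      have := hN q
      rw [h6]
      field_simp
      ring
    -- The shifted height is |z₀|²/|z|² for z spanning the line, nonzero exactly on this chart.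
    -- Dividing the horizontal coordinates z̄₀z₁/|z|² by it returns z₁/z₀.
    refine ⟨fun v => v.1 6 + 1 / 2, fun v => (v.1 0 + v.1 1 * Complex.I,
      (v.1 4 + v.1 5 * Complex.I) / ((v.1 6 + 1 / 2 : ℝ) : ℂ)),
      (hk 6).add continuous_const, ?_, ?_, ?_⟩
    · intro v hv
      refine ContinuousAt.prodMk (by fun_prop) (ContinuousAt.div (by fun_prop) (by fun_prop) ?_)
      exact Complex.ofReal_ne_zero.mpr hv
    · intro q
      simp only [hc, ne_eq, div_eq_zero_iff, hN q, or_false, pow_eq_zero_iff, OfNat.ofNat_ne_zero,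
        not_false_eq_true, norm_eq_zero]
      rfl
    · intro q hq
      refine Prod.ext (Complex.re_add_im (q.vec 0)) ?_
      have hq' : q.line.rep 0 ≠ 0 := hq
      change ((embed q).1 4 + (embed q).1 5 * Complex.I) / (((embed q).1 6 + 1 / 2 : ℝ) : ℂ) =
        q.line.rep 1 / q.line.rep 0
      rw [hc, h4, h5]
      have hN' := hN q
      have hcN : ((‖q.line.rep 0‖ ^ 2 + ‖q.line.rep 1‖ ^ 2 : ℝ) : ℂ) ≠ 0 := by exact_mod_cast hN'
      rw [Complex.ofReal_div, Complex.ofReal_div, Complex.ofReal_div, div_mul_eq_mul_div, ← add_div,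
        Complex.re_add_im, div_div_div_cancel_right₀ hcN, Complex.ofReal_pow, ← Complex.conj_mul']
      have := (map_ne_zero (starRingEnd ℂ)).mpr hq'
      field_simp
  · have hc : ∀ q : TautBundle, 1 / 2 - (embed q).1 6 =
        ‖q.line.rep 1‖ ^ 2 / (‖q.line.rep 0‖ ^ 2 + ‖q.line.rep 1‖ ^ 2) := fun q => by
      have := hN q
      rw [h6]
      field_simp
      ring
    -- The roles of the poles are exchanged, and conjugation turns z̄₀z₁ into z₀z̄₁, whose quotient
    -- by |z₁|² is z₀/z₁.
    refine ⟨fun v => 1 / 2 - v.1 6, fun v => (v.1 2 + v.1 3 * Complex.I,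
      conj (v.1 4 + v.1 5 * Complex.I) / ((1 / 2 - v.1 6 : ℝ) : ℂ)),
      continuous_const.sub (hk 6), ?_, ?_, ?_⟩
    · intro v hv
      refine ContinuousAt.prodMk (by fun_prop) (ContinuousAt.div
        (Complex.continuous_conj.continuousAt.comp (by fun_prop)) (by fun_prop) ?_)
      exact Complex.ofReal_ne_zero.mpr hv
    · intro q
      simp only [hc, ne_eq, div_eq_zero_iff, hN q, or_false, pow_eq_zero_iff, OfNat.ofNat_ne_zero,
        not_false_eq_true, norm_eq_zero]
      rfl
    · intro q hq
      refine Prod.ext (Complex.re_add_im (q.vec 1)) ?_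
      have hq' : q.line.rep 1 ≠ 0 := hq
      change conj ((embed q).1 4 + (embed q).1 5 * Complex.I) / ((1 / 2 - (embed q).1 6 : ℝ) : ℂ) =
        q.line.rep 0 / q.line.rep 1
      rw [hc, h4, h5]
      have hN' := hN q
      have hcN : ((‖q.line.rep 0‖ ^ 2 + ‖q.line.rep 1‖ ^ 2 : ℝ) : ℂ) ≠ 0 := by exact_mod_cast hN'
      rw [Complex.ofReal_div, Complex.ofReal_div, Complex.ofReal_div, div_mul_eq_mul_div, ← add_div,
        Complex.re_add_im, map_div₀, Complex.conj_ofReal, div_div_div_cancel_right₀ hcN,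
        Complex.ofReal_pow, ← Complex.conj_mul', map_mul, Complex.conj_conj]
      have := (map_ne_zero (starRingEnd ℂ)).mpr hq'
      field_simp

/-- If `embed q` is close to `embed p`, then `c` is nonzero there, so `q` lies in the chart of `p`
and is recovered continuously from `embed q` by `φ` and the inverse chart. -/
theorem isEmbedding_embed : Topology.IsEmbedding embed := by
  refine ⟨Topology.isInducing_iff_nhds.mpr fun p => le_antisymm
    (contMDiff_embed.continuous.continuousAt.tendsto.le_comap) ?_, embed_injective⟩
  obtain ⟨c, φ, hc, hφ, hcq, hφq⟩ := exists_chart_factor p.chartIndex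
  have hp := p.rep_chartIndex_ne_zero
  have hcp := (hcq p).mpr hp
  have hs : ContinuousAt (chartAt (ℂ × ℂ) p).symm (φ (embed p)) :=
    (chartAt (ℂ × ℂ) p).symm.continuousAt (Set.mem_univ _)
  have hps : (chartAt (ℂ × ℂ) p).symm (φ (embed p)) = p := by
    rw [hφq p hp]
    exact (chartAt (ℂ × ℂ) p).left_inv (mem_chart_source _ p)
  have ht : Filter.Tendsto (fun q => (chartAt (ℂ × ℂ) p).symm (φ (embed q)))
      (Filter.comap embed (𝓝 (embed p))) (𝓝 p) := by
    have h1 := hs.tendsto.comp ((hφ _ hcp).tendsto.comp (Filter.tendsto_comap (f := embed)))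
    rw [hps] at h1
    exact h1
  have hev : ∀ᶠ q in Filter.comap embed (𝓝 (embed p)),
      (chartAt (ℂ × ℂ) p).symm (φ (embed q)) = q := by
    filter_upwards [Filter.preimage_mem_comap (hc.continuousAt.eventually_ne hcp)] with q hq
    have hq' := (hcq q).mp hq
    rw [hφq q hq']
    exact (chartAt (ℂ × ℂ) p).left_inv hq'
  have := ht.congr' hev
  exact Filter.tendsto_id'.mp this

theorem isIsometricEmbedding_embed : IsIsometricEmbedding burnsMetric embed :=
  ⟨contMDiff_embed, isEmbedding_embed, embed_pullback⟩

end TautBundle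

namespace TautBundle

open RiemGeom

theorem hasEmbeddingClass_burnsMetric : HasEmbeddingClass burnsMetric 3 := by
  have hE : Module.finrank ℝ (ℂ × ℂ) = 4 := by
    rw [Module.finrank_prod, Complex.finrank_real_complex]
  refine ⟨⟨7, 0, ?_, embed, isIsometricEmbedding_embed⟩, ?_⟩
  · rw [hE]
    norm_num
  · rintro m ⟨r, s, hm, f, hf⟩
    by_contra hlt
    rw [hE] at hm
    -- A value below 3 means r + s ≤ 6, so all smaller dimensions are excluded together with six.
    exact not_isIsometricEmbedding (by omega) f hf

end TautBundle

end

open RiemGeom TautBundle in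
theorem theorem1p1 :
    -- the Burns metric is a scalar-flat Kähler metric
    IsScalarFlat burnsMetric ∧ IsKahler burnsMetric ∧
    -- its isometric embedding class is 3
    HasEmbeddingClass burnsMetric 3 ∧
    -- there is no isometric embedding into a six-dimensional pseudo-Euclidean space
    (∀ r s : ℕ, r + s = 6 →
      ¬ ∃ f : TautBundle → PseudoEuclidean r s, IsIsometricEmbedding burnsMetric f) ∧
    -- at every point, the third and fifth power traces of `P` vanish, and yet the Gauss equation
    -- has no real solution
    (∀ (p : TautBundle) (e : Fin 4 → TangentSpace 𝓘(ℝ, ℂ × ℂ) p), IsFrame burnsMetric p e →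
      (pTensor (riemannFrame burnsMetric p e) ^ 3).trace = 0 ∧
      (pTensor (riemannFrame burnsMetric p e) ^ 5).trace = 0 ∧
      (¬ ∃ X Y : PairMatrix, IsGaussSummand X ∧ IsGaussSummand Y ∧
        pTensor (riemannFrame burnsMetric p e) = X + Y) ∧
      ∀ ε₁ ε₂ : ℝ, (ε₁ = 1 ∨ ε₁ = -1) → (ε₂ = 1 ∨ ε₂ = -1) →
        ¬ ∃ K L : Matrix (Fin 4) (Fin 4) ℝ,
          SolvesGauss (riemannFrame burnsMetric p e) ε₁ ε₂ K L) ∧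
    -- there is an isometric embedding into `ℝ^7 = ℝ^4 × ℝ^3` whose components are the blow-down map
    -- to flat `ℝ^4 = ℂ²` and the projection to the projective line, identified with the round
    -- sphere of radius `1/2` in `ℝ^3`
    (∃ (f : TautBundle → PseudoEuclidean 7 0) (S : ℙ ℂ (Fin 2 → ℂ) → EuclideanSpace ℝ (Fin 3)),
      IsIsometricEmbedding burnsMetric f ∧
      Function.Injective S ∧ Set.range S = Metric.sphere 0 (1 / 2) ∧
      ∀ p : TautBundle, (f p).1 = !₂[(p.vec 0).re, (p.vec 0).im, (p.vec 1).re, (p.vec 1).im,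
        S p.line 0, S p.line 1, S p.line 2]) := by
  refine ⟨fun p e he => (isBurnsLike_riemannFrame p e he).scalar_eq_zero, isKahler_burnsMetric,
    hasEmbeddingClass_burnsMetric, fun r s h => ?_, fun p e he => ?_, ?_⟩
  · rintro ⟨f, hf⟩
    exact not_isIsometricEmbedding h.le f hf
  · have h := isBurnsLike_riemannFrame p e he
    exact ⟨h.trace_pTensor.1, h.trace_pTensor.2, h.not_gaussSummands,
      fun ε₁ ε₂ _ _ => h.not_solvesGauss ε₁ ε₂⟩
  · exact ⟨embed, lineToSphere, isIsometricEmbedding_embed, lineToSphere_injective,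
      range_lineToSphere, fun _ => rfl⟩
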